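/- Let $K$ be a field with algebraic closure $\overline{K}$, and let $f$ be a rational function of degree $3$ defined over $K$, regarded as an endomorphism of $\mathbb{P}^1$. For $\rho\in \mathrm{PGL}_2(\overline{K})$ put $f^{\rho}=\rho^{-1}\circ f\circ\rho$, and let $\mathrm{Aut}(f)=\{\rho\in \mathrm{PGL}_2(\overline{K}) : f^{\rho}=f\}$. Fixed points are taken in $\mathbb{P}^1(\overline{K})$ and counted without multiplicity. The multiplier of a fixed point $P$ is $f'(P)\in\overline{K}$, computed in the coordinate $1/z$ if $P=\infty$. A rational function is in \emph{partial fixed-point multiplier form} if either it has at most two fixed points and each of them is equal to its multiplier, or it has four fixed points and at least three of them are equal to their multipliers. The first dynatomic Galois group of $f$ is $\mathrm{Gal}(L/K)$, where $L$ is the field generated over $K$ by the finite fixed points of $f$ in $\overline{K}$. Write $\mathbb{Z}_2$ for the group of order $2$. Assume that $\mathrm{Aut}(f)$ has order $2$ and that $f$ has at least three distinct fixed points. Then there exists $\rho\in \mathrm{PGL}_2(\overline{K})$ such that $f^{\rho}$ is in partial fixed-point multiplier form if and only if $f$ has four fixed points, the first dynatomic Galois group of $f$ is isomorphic to the trivial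 group, $\mathbb{Z}_2$ or $\mathbb{Z}_2\times\mathbb{Z}_2$, and $f$ has at least three distinct fixed-point multipliers. Whenever $f$ has at least three distinct fixed-point multipliers (in particular, whenever such a $\rho$ exists), there are exactly two such $\rho\in \mathrm{PGL}_2(\overline{K})$. Moreover, for every such $\rho$ the map $f^{\rho}$ is defined over $K$. -/

import Mathlib

open scoped MatrixGroups

noncomputable section

namespace P1Map

variable {F : Type*} [Field F]

/-- The degree of a rational function `p / q` (in lowest terms) as a self-map of the projective
line: the maximum of the degrees of `p` and `q`. -/
def degree (f : RatFunc F) : ℕ :=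
  max f.num.natDegree f.denom.natDegree

/-- The value of a rational function at a point of the projective line `F ∪ {∞}`. -/
def value (f : RatFunc F) : OnePoint F → OnePoint F
  | .some x =>
      open Classical in
      if f.denom.eval x = 0 then OnePoint.infty
      else ((f.num.eval x / f.denom.eval x : F) : OnePoint F)
  | OnePoint.infty =>
      if f.denom.natDegree < f.num.natDegree then OnePoint.infty
      else ((f.num.coeff f.denom.natDegree / f.denom.coeff f.denom.natDegree : F) : OnePoint F)

/-- The set `Fix(f)` of fixed points of `f` in the projective line `F ∪ {∞}`. -/
def fixedPoints (f : RatFunc F) : Set (OnePoint F) :=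
  {P | value f P = P}

/-- The composition `f ∘ g`, that is, the substitution of `g` for the variable in `f`
(used here only for nonconstant `g`). -/
def comp (f g : RatFunc F) : RatFunc F :=
  RatFunc.eval RatFunc.C g f

/-- The linear fractional transformation `(a z + b) / (c z + d)`. -/
def mobius (A : GL (Fin 2) F) : RatFunc F :=
  (RatFunc.C (A 0 0) * RatFunc.X + RatFunc.C (A 0 1)) /
    (RatFunc.C (A 1 0) * RatFunc.X + RatFunc.C (A 1 1))

/-- The conjugate `A⁻¹ ∘ f ∘ A` by an invertible matrix. -/
def conjGL (A : GL (Fin 2) F) (f : RatFunc F) : RatFunc F :=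
  comp (mobius A⁻¹) (comp f (mobius A))

/-- The conjugate `f ^ ρ = ρ⁻¹ ∘ f ∘ ρ` by an element of `PGL₂`. It is computed with a matrix
representing `ρ`, and does not depend on the choice of this matrix (`conj_mk`). -/
def conj (ρ : PGL(2, F)) (f : RatFunc F) : RatFunc F :=
  conjGL (Function.surjInv Matrix.ProjGenLinGroup.mk_surjective ρ) f

lemma mobius_mul_scalar (A : GL (Fin 2) F) (u : Fˣ) :
    mobius (A * Matrix.GeneralLinearGroup.scalar (Fin 2) u) = mobius A := by
  have hu : (RatFunc.C (u : F) : RatFunc F) ≠ 0 := by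
    simp
  have h : ∀ i j, (A * Matrix.GeneralLinearGroup.scalar (Fin 2) u) i j = u * A i j := by
    intro i j
    simp [Matrix.scalar_apply, Matrix.mul_diagonal, mul_comm]
  simp only [mobius, h, map_mul, mul_assoc, ← mul_add]
  rw [mul_div_mul_left _ _ hu]

lemma conj_mk (A : GL (Fin 2) F) (f : RatFunc F) :
    conj (Matrix.ProjGenLinGroup.mk A) f = conjGL A f := by
  unfold conj
  generalize hB : Function.surjInv Matrix.ProjGenLinGroup.mk_surjective
    (Matrix.ProjGenLinGroup.mk A) = B
  have h : Matrix.ProjGenLinGroup.mk A = Matrix.ProjGenLinGroup.mk B := by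
    rw [← hB, Function.surjInv_eq Matrix.ProjGenLinGroup.mk_surjective]
  obtain ⟨u, rfl⟩ := Matrix.ProjGenLinGroup.mk_eq_mk_iff.1 h
  have h2 : (A * Matrix.GeneralLinearGroup.scalar (Fin 2) u)⁻¹ =
      A⁻¹ * Matrix.GeneralLinearGroup.scalar (Fin 2) u⁻¹ := by
    rw [mul_inv_rev, ← map_inv, Matrix.GeneralLinearGroup.scalar_commute]
  rw [conjGL, h2, mobius_mul_scalar, mobius_mul_scalar, conjGL]

/-- The set `Aut(f)` of all `ρ` in `PGL₂` with `f ^ ρ = f`. -/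
def automorphisms (f : RatFunc F) : Set PGL(2, F) :=
  {ρ | conj ρ f = f}

/-- The value at `x` of the derivative `(p' q - p q') / q ^ 2` of `f = p / q`. -/
def derivAt (f : RatFunc F) (x : F) : F :=
  (f.num.derivative.eval x * f.denom.eval x - f.num.eval x * f.denom.derivative.eval x) /
    f.denom.eval x ^ 2

/-- The inversion `z ↦ 1 / z`. -/
def inversion : GL (Fin 2) F :=
  Matrix.GeneralLinearGroup.mkOfDetNeZero !![0, 1; 1, 0] (by simp)

/-- The multiplier of `f` at a fixed point: the derivative there, computed after the change of
coordinate `z ↦ 1 / z` if the fixed point is `∞`. -/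
def multiplier (f : RatFunc F) : OnePoint F → F
  | .some x => derivAt f x
  | OnePoint.infty => derivAt (conjGL inversion f) 0

/-- The set of fixed-point multipliers of `f`. -/
def multipliers (f : RatFunc F) : Set F :=
  multiplier f '' fixedPoints f

/-- Partial fixed-point multiplier form: either `f` has at most two fixed points and each of them
is equal to its multiplier, or `f` has four fixed points and at least three of them are equal to
their multipliers. -/
def IsPartialFixedPointMultiplierForm (f : RatFunc F) : Prop :=
  ((fixedPoints f).encard ≤ 2 ∧ ∀ P ∈ fixedPoints f, P = ((multiplier f P : F) : OnePoint F)) ∨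
    ((fixedPoints f).encard = 4 ∧
      3 ≤ {P ∈ fixedPoints f | P = ((multiplier f P : F) : OnePoint F)}.encard)

/-- The rational function over an extension field with the same coefficients. -/
def baseChange {K : Type*} (F : Type*) [Field K] [Field F] [Algebra K F] (f : RatFunc K) :
    RatFunc F :=
  algebraMap (Polynomial F) (RatFunc F) (f.num.map (algebraMap K F)) /
    algebraMap (Polynomial F) (RatFunc F) (f.denom.map (algebraMap K F))

/-- `f` is defined over the subfield `K`. -/
def IsDefinedOver (K : Type*) {F : Type*} [Field K] [Field F] [Algebra K F] (f : RatFunc F) :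
    Prop :=
  ∃ g : RatFunc K, baseChange F g = f

/-- The first dynatomic field of `f`: the field generated over `K`, inside an algebraic closure,
by the (finite) fixed points of `f`. -/
def firstDynatomicField {K : Type*} [Field K] (f : RatFunc K) :
    IntermediateField K (AlgebraicClosure K) :=
  IntermediateField.adjoin K
    {x | (x : OnePoint (AlgebraicClosure K)) ∈ fixedPoints (baseChange (AlgebraicClosure K) f)}

/-- The first dynatomic Galois group of `f`. -/
abbrev FirstDynatomicGaloisGroup {K : Type*} [Field K] (f : RatFunc K) : Type _ :=
  firstDynatomicField f ≃ₐ[K] firstDynatomicField f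

end P1Map

end

/-! Write `f` as a pair `M` of binary cubic forms over `K` without common zero over the algebraic
closure. In homogeneous coordinates, "`P` is fixed with multiplier `l`" is a condition on the trace
of a Jacobian, uniform in `P` and invariant under conjugation (`CubicPair.hasMultiplier_conj_iff`,
`CubicPair.Nondegenerate.hasMultiplier_iff`). Let `λ(P)` denote the multiplier at `P`. Since there
are at least three fixed points, conjugating by `A` gives partial fixed-point multiplier form
exactly when there are four fixed points and at least three of them satisfy `P = A • λ(P)`. Such
points have distinct multipliers, so a solution forces three distinct multipliers.

Conversely, assume three distinct multipliers and let `S` be a nontrivial automorphism. It permutes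
the fixed points and preserves multipliers. It cannot fix three points, so it moves one of three
fixed points with distinct multipliers, necessarily to a fourth one. A cubic map has at most four
fixed points, so `S` swaps `P₁, P₂`, fixes `P₃, P₄`, and the only coincidence among multipliers is
`λ(P₁) = λ(P₂)` (`exists_isSwapConfiguration`). Three matching points must then be `P₃`, `P₄` and
exactly one of `P₁`, `P₂`. By sharp three-transitivity of `PGL₂` there are exactly two solutions,
`A` and `S * A` (`exists_setOf_eq_pair`), and both give the same conjugate since `S` is an
automorphism (`conj_eq_conj`).

An automorphism of the closure over `K` preserves the pairs `{P₁, P₂}` and `{P₃, P₄}`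
(`map_algEquiv`). This embeds the dynatomic Galois group in a Klein four-group. It also carries
solutions to solutions, so the unique conjugate is Galois invariant. Four distinct fixed points are
separable over `K`, so the conjugate has separable coefficients, and after normalization these
descend to `K` in every characteristic (`CubicPair.Nondegenerate.isDefinedOver`). -/

/-! ### Homogeneous coordinates on the projective line -/

/-- The point of the projective line with homogeneous coordinates `x`, `y`. -/
def OnePoint.ofCoords {F : Type*} [Field F] [DecidableEq F] (x y : F) : OnePoint F :=
  if y = 0 then OnePoint.infty else ((x / y : F) : OnePoint F)

namespace OnePoint

variable {F : Type*} [Field F] [DecidableEq F]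

lemma ofCoords_one (x : F) : ofCoords x 1 = (x : OnePoint F) := by simp [ofCoords]

lemma ofCoords_zero (x : F) : ofCoords x 0 = infty := by simp [ofCoords]

lemma exists_eq_ofCoords (P : OnePoint F) : ∃ x y, (x ≠ 0 ∨ y ≠ 0) ∧ P = ofCoords x y := by
  induction P using OnePoint.rec with
  | infty => exact ⟨1, 0, by simp [ofCoords]⟩
  | coe x => exact ⟨x, 1, by simp [ofCoords]⟩

lemma ofCoords_eq_coe_iff {x y z : F} :
    ofCoords x y = (z : OnePoint F) ↔ y ≠ 0 ∧ x = z * y := by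
  unfold ofCoords
  split_ifs with hy
  · simp [hy]
  · rw [coe_eq_coe, div_eq_iff hy]
    simp [hy]

lemma ofCoords_eq_infty_iff {x y : F} : ofCoords x y = infty ↔ y = 0 := by
  unfold ofCoords
  split_ifs with hy <;> simp [hy]

/-- Cross-multiplication detects proportionality only between nonzero vectors; `ofCoords 0 0` has
the default value `infty`, hence the two hypotheses. -/
lemma ofCoords_eq_ofCoords_iff {x y z w : F} (h : x ≠ 0 ∨ y ≠ 0) (h' : z ≠ 0 ∨ w ≠ 0) :
    ofCoords x y = ofCoords z w ↔ x * w = z * y := by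
  by_cases hw : w = 0
  · subst hw
    rw [ofCoords_zero, ofCoords_eq_infty_iff]
    simp_all
  · conv_lhs => rhs; rw [ofCoords, if_neg hw]
    rw [ofCoords_eq_coe_iff]
    constructor
    · rintro ⟨hy, rfl⟩
      field_simp
    · intro e
      have : x = z / w * y := by field_simp; exact e
      refine ⟨?_, this⟩
      rintro rfl
      simp_all

lemma smul_ofCoords (A : GL (Fin 2) F) {x y : F} (h : x ≠ 0 ∨ y ≠ 0) :
    A • ofCoords x y = ofCoords (A 0 0 * x + A 0 1 * y) (A 1 0 * x + A 1 1 * y) := by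
  unfold ofCoords
  by_cases hy : y = 0
  · subst hy
    have hx : x ≠ 0 := by simpa using h
    simp [smul_infty_eq_ite, hx, mul_div_mul_right]
  · rw [if_neg hy, smul_some_eq_ite]
    have h1 : A 1 0 * (x / y) + A 1 1 = (A 1 0 * x + A 1 1 * y) / y := by field_simp
    have h0 : A 0 0 * (x / y) + A 0 1 = (A 0 0 * x + A 0 1 * y) / y := by field_simp
    simp only [h0, h1, div_div_div_cancel_right₀ hy, div_eq_zero_iff, hy, or_false]

lemma map_ofCoords {L : Type*} [Field L] [DecidableEq L] (φ : F →+* L) (x y : F) :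
    (ofCoords x y).map φ = ofCoords (φ x) (φ y) := by
  unfold ofCoords
  by_cases hy : y = 0 <;> simp [hy]

end OnePoint

lemma Matrix.GeneralLinearGroup.apply_mul_apply_fin_two {F : Type*} [Field F] {A B : GL (Fin 2) F}
    (h : A * B = 1) :
    A 0 0 * B 0 0 + A 0 1 * B 1 0 = 1 ∧ A 0 0 * B 0 1 + A 0 1 * B 1 1 = 0 ∧
      A 1 0 * B 0 0 + A 1 1 * B 1 0 = 0 ∧ A 1 0 * B 0 1 + A 1 1 * B 1 1 = 1 := by
  have e : ∀ i j, (A * B) i j = (1 : GL (Fin 2) F) i j := fun i j ↦ by rw [h]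
  have h00 := e 0 0
  have h01 := e 0 1
  have h10 := e 1 0
  have h11 := e 1 1
  simp [Matrix.mul_apply, Fin.sum_univ_two] at h00 h01 h10 h11
  exact ⟨h00, h01, h10, h11⟩

/-! ### Binary cubic forms -/

/-- The binary cubic form `c₃ x³ + c₂ x² y + c₁ x y² + c₀ y³`. -/
@[ext]
structure BinaryCubic (F : Type*) where
  /-- The coefficient of `y³`. -/
  c₀ : F
  /-- The coefficient of `x y²`. -/
  c₁ : F
  /-- The coefficient of `x² y`. -/
  c₂ : F
  /-- The coefficient of `x³`. -/
  c₃ : F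

namespace BinaryCubic

section Ring

variable {R S : Type*} [CommRing R] [CommRing S]

/-- The value of a form. -/
def eval (p : BinaryCubic R) (x y : R) : R :=
  p.c₃ * x ^ 3 + p.c₂ * x ^ 2 * y + p.c₁ * x * y ^ 2 + p.c₀ * y ^ 3

/-- The partial derivative with respect to the first variable. -/
def dx (p : BinaryCubic R) (x y : R) : R :=
  3 * p.c₃ * x ^ 2 + 2 * p.c₂ * x * y + p.c₁ * y ^ 2

/-- The partial derivative with respect to the second variable. -/
def dy (p : BinaryCubic R) (x y : R) : R :=
  p.c₂ * x ^ 2 + 2 * p.c₁ * x * y + 3 * p.c₀ * y ^ 2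

/-- The form with coefficients moved along a ring homomorphism. -/
def map (φ : R →+* S) (p : BinaryCubic R) : BinaryCubic S :=
  ⟨φ p.c₀, φ p.c₁, φ p.c₂, φ p.c₃⟩

/-- The linear combination `s p + t q`. -/
def lin (s t : R) (p q : BinaryCubic R) : BinaryCubic R :=
  ⟨s * p.c₀ + t * q.c₀, s * p.c₁ + t * q.c₁, s * p.c₂ + t * q.c₂, s * p.c₃ + t * q.c₃⟩

/-- The form `p (a x + b y, c x + d y)`. -/
def subst (a b c d : R) (p : BinaryCubic R) : BinaryCubic R where
  -- Taylor expansion of `p` at `x (a, c) + y (b, d)`: the mixed coefficients are directional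
  -- derivatives at one vector along the other.
  c₀ := p.eval b d
  c₁ := a * p.dx b d + c * p.dy b d
  c₂ := b * p.dx a c + d * p.dy a c
  c₃ := p.eval a c

lemma eval_subst (a b c d : R) (p : BinaryCubic R) (x y : R) :
    (p.subst a b c d).eval x y = p.eval (a * x + b * y) (c * x + d * y) := by
  simp only [subst, eval, dx, dy]
  ring

lemma dx_subst (a b c d : R) (p : BinaryCubic R) (x y : R) :
    (p.subst a b c d).dx x y =
      a * p.dx (a * x + b * y) (c * x + d * y) + c * p.dy (a * x + b * y) (c * x + d * y) := by
  simp only [subst, eval, dx, dy]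
  ring

lemma dy_subst (a b c d : R) (p : BinaryCubic R) (x y : R) :
    (p.subst a b c d).dy x y =
      b * p.dx (a * x + b * y) (c * x + d * y) + d * p.dy (a * x + b * y) (c * x + d * y) := by
  simp only [subst, eval, dx, dy]
  ring

lemma eval_lin (s t : R) (p q : BinaryCubic R) (x y : R) :
    (lin s t p q).eval x y = s * p.eval x y + t * q.eval x y := by
  simp only [lin, eval]
  ring

lemma dx_lin (s t : R) (p q : BinaryCubic R) (x y : R) :
    (lin s t p q).dx x y = s * p.dx x y + t * q.dx x y := by
  simp only [lin, dx]
  ring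

lemma dy_lin (s t : R) (p q : BinaryCubic R) (x y : R) :
    (lin s t p q).dy x y = s * p.dy x y + t * q.dy x y := by
  simp only [lin, dy]
  ring

lemma euler (p : BinaryCubic R) (x y : R) : x * p.dx x y + y * p.dy x y = 3 * p.eval x y := by
  simp only [eval, dx, dy]
  ring

lemma eval_map (φ : R →+* S) (p : BinaryCubic R) (x y : R) :
    (p.map φ).eval (φ x) (φ y) = φ (p.eval x y) := by
  simp [map, eval]

lemma dx_map (φ : R →+* S) (p : BinaryCubic R) (x y : R) :
    (p.map φ).dx (φ x) (φ y) = φ (p.dx x y) := by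
  simp [map, dx, map_ofNat φ 3, map_ofNat φ 2]

lemma dy_map (φ : R →+* S) (p : BinaryCubic R) (x y : R) :
    (p.map φ).dy (φ x) (φ y) = φ (p.dy x y) := by
  simp [map, dy, map_ofNat φ 3, map_ofNat φ 2]

lemma map_lin (φ : R →+* S) (s t : R) (p q : BinaryCubic R) :
    (lin s t p q).map φ = lin (φ s) (φ t) (p.map φ) (q.map φ) := by
  simp [map, lin]

lemma map_subst (φ : R →+* S) (a b c d : R) (p : BinaryCubic R) :
    (p.subst a b c d).map φ = (p.map φ).subst (φ a) (φ b) (φ c) (φ d) := by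
  simp [map, subst, eval, dx, dy, map_ofNat φ 3, map_ofNat φ 2]

lemma map_map {T : Type*} [CommRing T] (φ : R →+* S) (ψ : S →+* T) (p : BinaryCubic R) :
    (p.map φ).map ψ = p.map (ψ.comp φ) := rfl

lemma eval_smul (p : BinaryCubic R) (t x y : R) : p.eval (t * x) (t * y) = t ^ 3 * p.eval x y := by
  simp only [eval]
  ring

lemma dx_smul (p : BinaryCubic R) (t x y : R) : p.dx (t * x) (t * y) = t ^ 2 * p.dx x y := by
  simp only [dx]
  ring

lemma dy_smul (p : BinaryCubic R) (t x y : R) : p.dy (t * x) (t * y) = t ^ 2 * p.dy x y := by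
  simp only [dy]
  ring

end Ring

end BinaryCubic

/-! ### Cubic maps, conjugation and homogeneous multipliers -/

/-- A pair of binary cubic forms, giving the self-map `[x : y] ↦ [p (x, y) : q (x, y)]` of the
projective line. -/
@[ext]
structure CubicPair (F : Type*) where
  /-- The numerator. -/
  p : BinaryCubic F
  /-- The denominator. -/
  q : BinaryCubic F

namespace CubicPair

variable {F L : Type*} [Field F] [Field L]

/-- The pair with coefficients moved along a ring homomorphism. -/
def map (φ : F →+* L) (M : CubicPair F) : CubicPair L := ⟨M.p.map φ, M.q.map φ⟩

/-- The conjugate `A⁻¹ ∘ M ∘ A`. -/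
def conj (A : GL (Fin 2) F) (M : CubicPair F) : CubicPair F where
  p := .lin (A⁻¹ 0 0) (A⁻¹ 0 1) (M.p.subst (A 0 0) (A 0 1) (A 1 0) (A 1 1))
    (M.q.subst (A 0 0) (A 0 1) (A 1 0) (A 1 1))
  q := .lin (A⁻¹ 1 0) (A⁻¹ 1 1) (M.p.subst (A 0 0) (A 0 1) (A 1 0) (A 1 1))
    (M.q.subst (A 0 0) (A 0 1) (A 1 0) (A 1 1))

lemma map_conj (φ : F →+* L) (A : GL (Fin 2) F) (M : CubicPair F) :
    (M.conj A).map φ = (M.map φ).conj (A.map φ) := by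
  have h (B : GL (Fin 2) F) (i j) : (B.map φ) i j = φ (B i j) := rfl
  simp only [map, conj, BinaryCubic.map_lin, BinaryCubic.map_subst, ← map_inv, h]

/-- The two forms have no common zero in the projective line. -/
def Nondegenerate (M : CubicPair F) : Prop :=
  ∀ x y, M.p.eval x y = 0 → M.q.eval x y = 0 → x = 0 ∧ y = 0

lemma Nondegenerate.conj {M : CubicPair F} (hM : M.Nondegenerate) (A : GL (Fin 2) F) :
    (M.conj A).Nondegenerate := by
  intro x y hp hq
  simp only [CubicPair.conj, BinaryCubic.eval_lin, BinaryCubic.eval_subst] at hp hq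
  obtain ⟨h1, h2, h3, h4⟩ :=
    Matrix.GeneralLinearGroup.apply_mul_apply_fin_two (mul_inv_cancel A)
  obtain ⟨g1, g2, g3, g4⟩ :=
    Matrix.GeneralLinearGroup.apply_mul_apply_fin_two (inv_mul_cancel A)
  obtain ⟨e1, e2⟩ := hM (A 0 0 * x + A 0 1 * y) (A 1 0 * x + A 1 1 * y)
    (by linear_combination A 0 0 * hp + A 0 1 * hq - h1 * M.p.eval _ _ - h2 * M.q.eval _ _)
    (by linear_combination A 1 0 * hp + A 1 1 * hq - h3 * M.p.eval _ _ - h4 * M.q.eval _ _)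
  constructor
  · linear_combination A⁻¹ 0 0 * e1 + A⁻¹ 0 1 * e2 - g1 * x - g2 * y
  · linear_combination A⁻¹ 1 0 * e1 + A⁻¹ 1 1 * e2 - g3 * x - g4 * y

variable [DecidableEq F] [DecidableEq L]

/-- The point `P` is fixed by the map `M`, with multiplier `l`. In homogeneous coordinates, the
trace of the Jacobian matrix of `M` at a vector `v` with `M v = c v` is `(l + 3) c`. -/
def HasMultiplier (M : CubicPair F) (P : OnePoint F) (l : F) : Prop :=
  ∃ x y c, (x ≠ 0 ∨ y ≠ 0) ∧ P = OnePoint.ofCoords x y ∧ c ≠ 0 ∧ M.p.eval x y = c * x ∧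
    M.q.eval x y = c * y ∧ M.p.dx x y + M.q.dy x y = (l + 3) * c

lemma HasMultiplier.map {M : CubicPair F} {P : OnePoint F} {l : F} (h : M.HasMultiplier P l)
    (φ : F →+* L) : (M.map φ).HasMultiplier (P.map φ) (φ l) := by
  obtain ⟨x, y, c, hxy, rfl, hc, hp, hq, ht⟩ := h
  refine ⟨φ x, φ y, φ c, by simpa using hxy, OnePoint.map_ofCoords φ x y, by simpa using hc, ?_⟩
  simp only [CubicPair.map, BinaryCubic.eval_map, BinaryCubic.dx_map, BinaryCubic.dy_map, hp, hq,
    ← _root_.map_add, ht]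
  simp [map_ofNat φ 3]

/-- The Jacobian of the conjugate at `v` is `A⁻¹ J A`, with `J` the Jacobian of `M` at `A v`. It has
the same trace, and the scalar `c` does not change. -/
lemma HasMultiplier.smul_of_conj {M : CubicPair F} {P : OnePoint F} {l : F} {A : GL (Fin 2) F}
    (h : (M.conj A).HasMultiplier P l) : M.HasMultiplier (A • P) l := by
  obtain ⟨x, y, c, hxy, rfl, hc, hp, hq, ht⟩ := h
  obtain ⟨h1, h2, h3, h4⟩ :=
    Matrix.GeneralLinearGroup.apply_mul_apply_fin_two (mul_inv_cancel A)
  obtain ⟨g1, g2, g3, g4⟩ :=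
    Matrix.GeneralLinearGroup.apply_mul_apply_fin_two (inv_mul_cancel A)
  simp only [conj, BinaryCubic.eval_lin, BinaryCubic.eval_subst, BinaryCubic.dx_lin,
    BinaryCubic.dx_subst, BinaryCubic.dy_lin, BinaryCubic.dy_subst] at hp hq ht
  refine ⟨A 0 0 * x + A 0 1 * y, A 1 0 * x + A 1 1 * y, c, ?_, OnePoint.smul_ofCoords A hxy, hc,
    ?_, ?_, ?_⟩
  · by_contra! ⟨e1, e2⟩
    have hx : x = 0 := by linear_combination A⁻¹ 0 0 * e1 + A⁻¹ 0 1 * e2 - g1 * x - g2 * y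
    have hy : y = 0 := by linear_combination A⁻¹ 1 0 * e1 + A⁻¹ 1 1 * e2 - g3 * x - g4 * y
    simp_all
  · linear_combination A 0 0 * hp + A 0 1 * hq - h1 * M.p.eval _ _ - h2 * M.q.eval _ _
  · linear_combination A 1 0 * hp + A 1 1 * hq - h3 * M.p.eval _ _ - h4 * M.q.eval _ _
  · linear_combination ht - h1 * M.p.dx _ _ - h2 * M.q.dx _ _ - h3 * M.p.dy _ _ - h4 * M.q.dy _ _

lemma HasMultiplier.conj_of_smul {M : CubicPair F} {P : OnePoint F} {l : F} {A : GL (Fin 2) F}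
    (h : M.HasMultiplier (A • P) l) : (M.conj A).HasMultiplier P l := by
  obtain ⟨x, y, c, hxy, hP, hc, hp, hq, ht⟩ := h
  obtain ⟨h1, h2, h3, h4⟩ :=
    Matrix.GeneralLinearGroup.apply_mul_apply_fin_two (mul_inv_cancel A)
  rw [eq_comm, ← inv_smul_eq_iff, OnePoint.smul_ofCoords _ hxy] at hP
  have e1 : A 0 0 * (A⁻¹ 0 0 * x + A⁻¹ 0 1 * y) + A 0 1 * (A⁻¹ 1 0 * x + A⁻¹ 1 1 * y) = x := by
    linear_combination h1 * x + h2 * y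
  have e2 : A 1 0 * (A⁻¹ 0 0 * x + A⁻¹ 0 1 * y) + A 1 1 * (A⁻¹ 1 0 * x + A⁻¹ 1 1 * y) = y := by
    linear_combination h3 * x + h4 * y
  refine ⟨_, _, c, ?_, hP.symm, hc, ?_⟩
  · by_contra! ⟨k1, k2⟩
    rw [k1, k2] at e1 e2
    simp only [mul_zero, add_zero] at e1 e2
    simp [← e1, ← e2] at hxy
  simp only [conj, BinaryCubic.eval_lin, BinaryCubic.eval_subst, BinaryCubic.dx_lin,
    BinaryCubic.dx_subst, BinaryCubic.dy_lin, BinaryCubic.dy_subst, e1, e2, hp, hq]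
  refine ⟨by ring, by ring, ?_⟩
  linear_combination ht + h1 * M.p.dx _ _ + h2 * M.q.dx _ _ + h3 * M.p.dy _ _ + h4 * M.q.dy _ _

lemma hasMultiplier_conj_iff {M : CubicPair F} {P : OnePoint F} {l : F} {A : GL (Fin 2) F} :
    (M.conj A).HasMultiplier P l ↔ M.HasMultiplier (A • P) l :=
  ⟨HasMultiplier.smul_of_conj, HasMultiplier.conj_of_smul⟩

/-- On the representative `(x, 1)` the scalar is `c = q (x, 1)`. Euler's identity for `q` replaces
`q_y` by `3 q - x q_x`, which turns the trace into `p_x - x q_x + 3 q`. -/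
lemma hasMultiplier_coe_iff {M : CubicPair F} {x l : F} :
    M.HasMultiplier x l ↔ M.q.eval x 1 ≠ 0 ∧ M.p.eval x 1 = M.q.eval x 1 * x ∧
      M.p.dx x 1 - x * M.q.dx x 1 = l * M.q.eval x 1 := by
  constructor
  · rintro ⟨z, y, c, hzy, hP, hc, hp, hq, ht⟩
    obtain ⟨hy, rfl⟩ := OnePoint.ofCoords_eq_coe_iff.1 hP.symm
    have e1 := M.p.eval_smul y x 1
    have e2 := M.q.eval_smul y x 1
    have e3 := M.p.dx_smul y x 1
    have e4 := M.q.dy_smul y x 1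
    rw [mul_one, mul_comm y x] at e1 e2 e3 e4
    rw [e1] at hp
    rw [e2] at hq
    rw [e3, e4] at ht
    have eu := M.q.euler x 1
    have hc' : c = y ^ 2 * M.q.eval x 1 := by
      apply mul_left_cancel₀ hy
      linear_combination -hq
    subst hc'
    have hq0 : M.q.eval x 1 ≠ 0 := by
      intro h; simp [h] at hc
    refine ⟨hq0, ?_, ?_⟩
    · apply mul_left_cancel₀ (pow_ne_zero 3 hy)
      linear_combination hp
    · apply mul_left_cancel₀ (pow_ne_zero 2 hy)
      linear_combination ht - y ^ 2 * eu
  · rintro ⟨hq, hp, ht⟩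
    refine ⟨x, 1, M.q.eval x 1, by simp, (OnePoint.ofCoords_one x).symm, hq, hp, by ring, ?_⟩
    linear_combination ht + M.q.euler x 1

lemma hasMultiplier_infty_iff {M : CubicPair F} {l : F} :
    M.HasMultiplier OnePoint.infty l ↔ M.p.c₃ ≠ 0 ∧ M.q.c₃ = 0 ∧ M.q.c₂ = l * M.p.c₃ := by
  constructor
  · rintro ⟨x, y, c, hxy, hP, hc, hp, hq, ht⟩
    obtain rfl := OnePoint.ofCoords_eq_infty_iff.1 hP.symm
    have hx : x ≠ 0 := by simpa using hxy
    simp only [BinaryCubic.eval, BinaryCubic.dx, BinaryCubic.dy] at hp hq ht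
    have hc' : c = x ^ 2 * M.p.c₃ := by
      apply mul_left_cancel₀ hx
      linear_combination -hp
    subst hc'
    refine ⟨by rintro h; simp [h] at hc, ?_, ?_⟩
    · apply mul_left_cancel₀ (pow_ne_zero 3 hx)
      linear_combination hq
    · apply mul_left_cancel₀ (pow_ne_zero 2 hx)
      linear_combination ht
  · rintro ⟨hp, hq, ht⟩
    refine ⟨1, 0, M.p.c₃, by simp, (OnePoint.ofCoords_zero 1).symm, hp, ?_⟩
    simp only [BinaryCubic.eval, BinaryCubic.dx, BinaryCubic.dy, hq]
    refine ⟨by ring, by ring, ?_⟩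
    linear_combination ht

end CubicPair

/-! ### From pairs of forms to rational functions -/

open Polynomial in
/-- The polynomial `p (X, 1)`. -/
noncomputable def BinaryCubic.toPoly {F : Type*} [Field F] (p : BinaryCubic F) : F[X] :=
  C p.c₃ * X ^ 3 + C p.c₂ * X ^ 2 + C p.c₁ * X + C p.c₀

/-- The rational function `p (X, 1) / q (X, 1)`. -/
noncomputable def CubicPair.toRatFunc {F : Type*} [Field F] (M : CubicPair F) : RatFunc F :=
  algebraMap (Polynomial F) (RatFunc F) M.p.toPoly / algebraMap (Polynomial F) (RatFunc F) M.q.toPoly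

namespace BinaryCubic

open Polynomial

variable {F : Type*} [Field F]

lemma eval_toPoly (p : BinaryCubic F) (x : F) : p.toPoly.eval x = p.eval x 1 := by
  simp [toPoly, eval]

lemma eval_derivative_toPoly (p : BinaryCubic F) (x : F) :
    p.toPoly.derivative.eval x = p.dx x 1 := by
  simp [toPoly, dx]
  ring

lemma coeff_toPoly (p : BinaryCubic F) :
    p.toPoly.coeff 0 = p.c₀ ∧ p.toPoly.coeff 1 = p.c₁ ∧ p.toPoly.coeff 2 = p.c₂ ∧
      p.toPoly.coeff 3 = p.c₃ := by
  simp [toPoly, coeff_X, coeff_C]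

lemma natDegree_toPoly_le (p : BinaryCubic F) : p.toPoly.natDegree ≤ 3 := by
  unfold toPoly
  compute_degree

lemma natDegree_toPoly {p : BinaryCubic F} (h : p.c₃ ≠ 0) : p.toPoly.natDegree = 3 := by
  unfold toPoly
  compute_degree!

lemma natDegree_toPoly_lt {p : BinaryCubic F} (h : p.c₃ = 0) : p.toPoly.natDegree < 3 := by
  unfold toPoly
  rw [h]
  simp only [map_zero, zero_mul, zero_add]
  exact lt_of_le_of_lt (natDegree_quadratic_le (a := p.c₂)) (by norm_num)

lemma toPoly_eq_zero {p : BinaryCubic F} (h : p.toPoly = 0) : p = ⟨0, 0, 0, 0⟩ := by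
  obtain ⟨h0, h1, h2, h3⟩ := p.coeff_toPoly
  rw [h] at h0 h1 h2 h3
  ext <;> simp_all

lemma exists_eval_eq_zero [IsAlgClosed F] (p : BinaryCubic F) :
    ∃ x y, (x ≠ 0 ∨ y ≠ 0) ∧ p.eval x y = 0 := by
  by_cases h : p.c₃ = 0
  · exact ⟨1, 0, by simp [eval, h]⟩
  · obtain ⟨x, hx⟩ := IsAlgClosed.exists_root p.toPoly
      (fun h0 ↦ by simpa [natDegree_toPoly h] using natDegree_eq_of_degree_eq_some h0)
    exact ⟨x, 1, by simp, by rwa [IsRoot, eval_toPoly] at hx⟩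

lemma toPoly_map {L : Type*} [Field L] (φ : F →+* L) (p : BinaryCubic F) :
    (p.map φ).toPoly = p.toPoly.map φ := by
  simp [toPoly, map]

lemma aeval_toPoly_div {R : Type*} [Field R] [Algebra F R] (p : BinaryCubic F) {x y : R}
    (hy : y ≠ 0) : aeval (x / y) p.toPoly = (p.map (algebraMap F R)).eval x y / y ^ 3 := by
  simp [toPoly, map, eval]
  field_simp

end BinaryCubic

open Classical in
lemma P1Map.value_coe {F : Type*} [Field F] (f : RatFunc F) (x : F) :
    value f (x : OnePoint F) = if f.denom.eval x = 0 then OnePoint.infty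
      else ((f.num.eval x / f.denom.eval x : F) : OnePoint F) := rfl

namespace CubicPair

open Polynomial

variable {F : Type*} [Field F]

section AlgClosed

variable [IsAlgClosed F]

/-- Over an algebraically closed field `p` has a projective zero, which would be a common zero if
`q` vanished identically. -/
lemma Nondegenerate.toPoly_q_ne_zero {M : CubicPair F} (hM : M.Nondegenerate) :
    M.q.toPoly ≠ 0 := by
  intro h
  obtain ⟨x, y, hxy, h0⟩ := M.p.exists_eval_eq_zero
  have := hM x y h0 (by rw [BinaryCubic.toPoly_eq_zero h]; simp [BinaryCubic.eval])
  simp_all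

lemma Nondegenerate.isCoprime {M : CubicPair F} (hM : M.Nondegenerate) :
    IsCoprime M.p.toPoly M.q.toPoly := by
  rw [isCoprime_iff_aeval_ne_zero_of_isAlgClosed F F]
  intro x
  by_contra! ⟨h1, h2⟩
  rw [coe_aeval_eq_eval, BinaryCubic.eval_toPoly] at h1 h2
  simpa using (hM x 1 h1 h2).2

/-- Coprimality leaves nothing to cancel; the scalar only makes the denominator monic. -/
lemma Nondegenerate.num_denom {M : CubicPair F} (hM : M.Nondegenerate) :
    ∃ s : F, s ≠ 0 ∧ M.toRatFunc.num = C s * M.p.toPoly ∧ M.toRatFunc.denom = C s * M.q.toPoly := by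
  classical
  have hg : gcd M.p.toPoly M.q.toPoly = 1 := by
    rw [← normalize_gcd, normalize_eq_one, gcd_isUnit_iff]
    exact hM.isCoprime
  refine ⟨(M.q.toPoly.leadingCoeff)⁻¹, by simpa using hM.toPoly_q_ne_zero, ?_, ?_⟩
  · rw [toRatFunc, RatFunc.num_div, hg, EuclideanDomain.div_one, EuclideanDomain.div_one]
  · rw [toRatFunc, RatFunc.denom_div _ hM.toPoly_q_ne_zero, hg, EuclideanDomain.div_one]

lemma Nondegenerate.exists_smul_of_toRatFunc_eq {M N : CubicPair F} (hM : M.Nondegenerate)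
    (hN : N.Nondegenerate) (h : M.toRatFunc = N.toRatFunc) :
    ∃ s : F, s ≠ 0 ∧ (∀ i, N.p.toPoly.coeff i = s * M.p.toPoly.coeff i) ∧
      ∀ i, N.q.toPoly.coeff i = s * M.q.toPoly.coeff i := by
  obtain ⟨s, hs, h1, h2⟩ := hM.num_denom
  obtain ⟨t, ht, h3, h4⟩ := hN.num_denom
  rw [h] at h1 h2
  refine ⟨t⁻¹ * s, by simp [hs, ht], fun i ↦ ?_, fun i ↦ ?_⟩
  · have := congrArg (coeff · i) (h1.symm.trans h3)
    simp only [coeff_C_mul] at this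
    rw [mul_assoc, this, inv_mul_cancel_left₀ ht]
  · have := congrArg (coeff · i) (h2.symm.trans h4)
    simp only [coeff_C_mul] at this
    rw [mul_assoc, this, inv_mul_cancel_left₀ ht]

lemma Nondegenerate.value_coe {M : CubicPair F} (hM : M.Nondegenerate) (x y : F) :
    P1Map.value M.toRatFunc (x : OnePoint F) = (y : OnePoint F) ↔
      M.q.eval x 1 ≠ 0 ∧ M.p.eval x 1 = M.q.eval x 1 * y := by
  obtain ⟨s, hs, h1, h2⟩ := hM.num_denom
  rw [P1Map.value_coe, h1, h2]
  simp only [eval_mul, eval_C, BinaryCubic.eval_toPoly, mul_div_mul_left _ _ hs]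
  split_ifs with h
  · replace h : M.q.eval x 1 = 0 := by simpa [hs, BinaryCubic.eval_toPoly] using h
    simp [h]
  · replace h : M.q.eval x 1 ≠ 0 := by simpa [hs, BinaryCubic.eval_toPoly] using h
    rw [OnePoint.coe_eq_coe, div_eq_iff h, mul_comm y]
    simp [h]

lemma Nondegenerate.value_infty {M : CubicPair F} (hM : M.Nondegenerate) :
    P1Map.value M.toRatFunc OnePoint.infty = OnePoint.infty ↔ M.p.c₃ ≠ 0 ∧ M.q.c₃ = 0 := by
  obtain ⟨s, hs, h1, h2⟩ := hM.num_denom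
  have h3 : M.q.c₃ = 0 → M.p.c₃ ≠ 0 := by
    intro hq hp
    simpa using (hM 1 0 (by simp [BinaryCubic.eval, hp]) (by simp [BinaryCubic.eval, hq])).1
  change (if _ then _ else _) = _ ↔ _
  rw [h1, h2, natDegree_C_mul hs, natDegree_C_mul hs]
  by_cases hq : M.q.c₃ = 0
  · rw [if_pos]
    · simp [hq, h3]
    · rw [BinaryCubic.natDegree_toPoly (h3 hq)]
      exact BinaryCubic.natDegree_toPoly_lt hq
  · rw [if_neg]
    · simp [hq]
    · rw [BinaryCubic.natDegree_toPoly hq, not_lt]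
      exact BinaryCubic.natDegree_toPoly_le _

lemma Nondegenerate.derivAt_eq {M : CubicPair F} (hM : M.Nondegenerate) (x : F) :
    P1Map.derivAt M.toRatFunc x =
      (M.p.dx x 1 * M.q.eval x 1 - M.p.eval x 1 * M.q.dx x 1) / M.q.eval x 1 ^ 2 := by
  obtain ⟨s, hs, h1, h2⟩ := hM.num_denom
  rw [P1Map.derivAt, h1, h2]
  simp only [eval_mul, eval_C, BinaryCubic.eval_toPoly, derivative_C_mul,
    BinaryCubic.eval_derivative_toPoly]
  -- At a pole both sides are divisions by zero, with default value `0`.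
  by_cases h : M.q.eval x 1 = 0
  · simp [h]
  · field_simp

end AlgClosed

end CubicPair

/-! ### Composition of rational functions and the dictionary with forms -/

namespace P1Map

open Polynomial

variable {F : Type*} [Field F]

open RatFunc in
-- Lets `comp` and `baseChange`, which are defined through reduced fractions, be computed from any
-- representing fraction.
lemma _root_.RatFunc.num_div_mul (p : F[X]) {q : F[X]} (hq : q ≠ 0) :
    (algebraMap F[X] (RatFunc F) p / algebraMap F[X] (RatFunc F) q).num * q =
      p * (algebraMap F[X] (RatFunc F) p / algebraMap F[X] (RatFunc F) q).denom := by
  apply RatFunc.algebraMap_injective F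
  have h2 := num_div_denom (algebraMap F[X] (RatFunc F) p / algebraMap F[X] (RatFunc F) q)
  rw [div_eq_div_iff (RatFunc.algebraMap_ne_zero (denom_ne_zero _))
    (RatFunc.algebraMap_ne_zero hq)] at h2
  rw [map_mul, map_mul, h2]

/-- Transcendence of `g` guarantees that no denominator vanishes under the substitution. -/
lemma comp_div {p q : F[X]} (hq : q ≠ 0) {g : RatFunc F} (hg : Transcendental F g) :
    comp (algebraMap F[X] (RatFunc F) p / algebraMap F[X] (RatFunc F) q) g =
      aeval g p / aeval g q := by
  set f := algebraMap F[X] (RatFunc F) p / algebraMap F[X] (RatFunc F) q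
  have hne : ∀ r : F[X], r ≠ 0 → aeval g r ≠ 0 := fun r hr h ↦
    hr ((transcendental_iff.1 hg) r h)
  have h1 : f.num * q = p * f.denom := RatFunc.num_div_mul p hq
  have h5 := congrArg (aeval g) h1
  rw [map_mul, map_mul] at h5
  change aeval g f.num / aeval g f.denom = _
  rw [div_eq_div_iff (hne _ f.denom_ne_zero) (hne _ hq), h5]

lemma eq_of_linear_eq {a b c d k : F}
    (h : C a * X + C b = C k * (C c * X + C d)) : a = k * c ∧ b = k * d := by
  have h0 := congrArg (coeff · 0) h
  have h1 := congrArg (coeff · 1) h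
  simp only [coeff_add, coeff_C_mul, coeff_X, coeff_C] at h0 h1
  simp at h0 h1
  exact ⟨h1, h0⟩

lemma linear_ne_zero (A : GL (Fin 2) F) : C (A 1 0) * X + C (A 1 1) ≠ 0 := by
  intro h
  obtain ⟨h1, h0⟩ := eq_of_linear_eq (a := A 1 0) (b := A 1 1) (c := 0) (d := 0) (k := 0)
    (by rw [h]; simp)
  apply A.det_ne_zero
  rw [Matrix.det_fin_two, h0, h1]
  simp

lemma mobius_eq_div (A : GL (Fin 2) F) :
    mobius A = algebraMap F[X] (RatFunc F) (C (A 0 0) * X + C (A 0 1)) /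
      algebraMap F[X] (RatFunc F) (C (A 1 0) * X + C (A 1 1)) := by
  simp [mobius]

lemma transcendental_mobius (A : GL (Fin 2) F) : Transcendental F (mobius A) := by
  apply RatFunc.transcendental_of_ne_C
  rintro ⟨k, hk⟩
  rw [mobius_eq_div, div_eq_iff (RatFunc.algebraMap_ne_zero (linear_ne_zero A)),
    ← RatFunc.algebraMap_C, ← map_mul] at hk
  obtain ⟨h1, h0⟩ := eq_of_linear_eq (RatFunc.algebraMap_injective F hk)
  apply A.det_ne_zero
  rw [Matrix.det_fin_two, h0, h1]
  ring

end P1Map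

namespace CubicPair

open Polynomial P1Map

variable {F : Type*} [Field F]

lemma Nondegenerate.subst {M : CubicPair F} (hM : M.Nondegenerate) (A : GL (Fin 2) F) :
    CubicPair.Nondegenerate ⟨M.p.subst (A 0 0) (A 0 1) (A 1 0) (A 1 1),
      M.q.subst (A 0 0) (A 0 1) (A 1 0) (A 1 1)⟩ := by
  intro x y hp hq
  rw [BinaryCubic.eval_subst] at hp hq
  obtain ⟨e1, e2⟩ := hM _ _ hp hq
  obtain ⟨g1, g2, g3, g4⟩ :=
    Matrix.GeneralLinearGroup.apply_mul_apply_fin_two (inv_mul_cancel A)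
  constructor
  · linear_combination A⁻¹ 0 0 * e1 + A⁻¹ 0 1 * e2 - g1 * x - g2 * y
  · linear_combination A⁻¹ 1 0 * e1 + A⁻¹ 1 1 * e2 - g3 * x - g4 * y

variable [IsAlgClosed F]

/-- A constant value `k` would give `p = k q`, and then any zero of `q` would be a common zero. -/
lemma Nondegenerate.transcendental_toRatFunc {M : CubicPair F} (hM : M.Nondegenerate) :
    Transcendental F M.toRatFunc := by
  apply RatFunc.transcendental_of_ne_C
  rintro ⟨k, hk⟩
  rw [toRatFunc, div_eq_iff (RatFunc.algebraMap_ne_zero hM.toPoly_q_ne_zero),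
    ← RatFunc.algebraMap_C, ← map_mul] at hk
  replace hk := RatFunc.algebraMap_injective F hk
  obtain ⟨x, y, hxy, h0⟩ := M.q.exists_eval_eq_zero
  obtain ⟨p0, p1, p2, p3⟩ := M.p.coeff_toPoly
  obtain ⟨q0, q1, q2, q3⟩ := M.q.coeff_toPoly
  rw [hk, coeff_C_mul] at p0 p1 p2 p3
  have := hM x y ?_ h0
  · simp_all
  · unfold BinaryCubic.eval at h0 ⊢
    rw [← p0, ← p1, ← p2, ← p3, q0, q1, q2, q3]
    linear_combination k * h0

lemma Nondegenerate.conjGL_toRatFunc {M : CubicPair F} (hM : M.Nondegenerate)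
    (A : GL (Fin 2) F) : conjGL A M.toRatFunc = (M.conj A).toRatFunc := by
  have hl : C (A 1 0) * X + C (A 1 1) ≠ 0 := linear_ne_zero A
  have hl' := RatFunc.algebraMap_ne_zero hl
  -- Substituting a fraction into a cubic produces the cube of its denominator; this factor is
  -- common to `p` and `q` and cancels.
  have key (p : BinaryCubic F) : aeval (mobius A) p.toPoly =
      algebraMap F[X] (RatFunc F) (p.subst (A 0 0) (A 0 1) (A 1 0) (A 1 1)).toPoly /
        algebraMap F[X] (RatFunc F) (C (A 1 0) * X + C (A 1 1)) ^ 3 := by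
    rw [mobius_eq_div, BinaryCubic.aeval_toPoly_div _ hl']
    congr 1
    simp [BinaryCubic.toPoly, BinaryCubic.subst, BinaryCubic.eval, BinaryCubic.map,
      BinaryCubic.dx, BinaryCubic.dy, map_ofNat RatFunc.C 3, map_ofNat RatFunc.C 2]
    ring
  have h1 : comp M.toRatFunc (mobius A) =
      toRatFunc ⟨M.p.subst (A 0 0) (A 0 1) (A 1 0) (A 1 1),
        M.q.subst (A 0 0) (A 0 1) (A 1 0) (A 1 1)⟩ := by
    rw [toRatFunc, comp_div hM.toPoly_q_ne_zero (transcendental_mobius A), key, key,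
      div_div_div_cancel_right₀ (pow_ne_zero 3 hl')]
    rfl
  have hs := hM.subst A
  have hq := RatFunc.algebraMap_ne_zero hs.toPoly_q_ne_zero
  rw [conjGL, h1, mobius_eq_div, comp_div (linear_ne_zero A⁻¹) hs.transcendental_toRatFunc]
  have key2 (a b : F) : aeval (toRatFunc ⟨M.p.subst (A 0 0) (A 0 1) (A 1 0) (A 1 1),
        M.q.subst (A 0 0) (A 0 1) (A 1 0) (A 1 1)⟩) (C a * X + C b) =
      algebraMap F[X] (RatFunc F) (BinaryCubic.lin a b
        (M.p.subst (A 0 0) (A 0 1) (A 1 0) (A 1 1))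
        (M.q.subst (A 0 0) (A 0 1) (A 1 0) (A 1 1))).toPoly /
      algebraMap F[X] (RatFunc F) (M.q.subst (A 0 0) (A 0 1) (A 1 0) (A 1 1)).toPoly := by
    rw [eq_div_iff hq]
    generalize M.p.subst (A 0 0) (A 0 1) (A 1 0) (A 1 1) = p at *
    generalize M.q.subst (A 0 0) (A 0 1) (A 1 0) (A 1 1) = q at *
    have : BinaryCubic.toPoly (.lin a b p q) = C a * p.toPoly + C b * q.toPoly := by
      simp [BinaryCubic.lin, BinaryCubic.toPoly]
      ring
    rw [this]
    simp only [map_add, map_mul, aeval_C, aeval_X, toRatFunc, RatFunc.algebraMap_C,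
      RatFunc.algebraMap_eq_C]
    field_simp
  rw [key2, key2, div_div_div_cancel_right₀ hq]
  rfl

variable [DecidableEq F]

lemma Nondegenerate.hasMultiplier_iff {M : CubicPair F} (hM : M.Nondegenerate) {P : OnePoint F}
    {l : F} : M.HasMultiplier P l ↔
      P ∈ fixedPoints M.toRatFunc ∧ multiplier M.toRatFunc P = l := by
  induction P using OnePoint.rec with
  | coe x =>
    rw [hasMultiplier_coe_iff]
    change _ ↔ value _ _ = _ ∧ derivAt _ _ = _
    rw [hM.value_coe, hM.derivAt_eq, and_assoc]
    refine and_congr_right fun hq ↦ and_congr_right fun hp ↦ ?_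
    rw [hp, div_eq_iff (pow_ne_zero 2 hq)]
    constructor
    · intro h
      linear_combination M.q.eval x 1 * h
    · intro h
      apply mul_left_cancel₀ hq
      linear_combination h
  | infty =>
    rw [hasMultiplier_infty_iff]
    change _ ↔ value _ _ = _ ∧ derivAt _ _ = _
    rw [hM.value_infty, hM.conjGL_toRatFunc, (hM.conj _).derivAt_eq, and_assoc]
    refine and_congr_right fun hp ↦ and_congr_right fun hq ↦ ?_
    -- As inversion is an involution, conjugating by it exchanges both the two forms and the two
    -- variables.
    have h1 : (inversion : GL (Fin 2) F)⁻¹ = inversion := by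
      rw [inv_eq_iff_mul_eq_one]
      ext i j
      fin_cases i <;> fin_cases j <;>
        simp [inversion, Matrix.mul_apply, Fin.sum_univ_two,
          Matrix.GeneralLinearGroup.mkOfDetNeZero]
    have h2 : (inversion : GL (Fin 2) F) 0 0 = 0 ∧ (inversion : GL (Fin 2) F) 0 1 = 1 ∧
      (inversion : GL (Fin 2) F) 1 0 = 1 ∧ (inversion : GL (Fin 2) F) 1 1 = 0 := by
      simp [inversion, Matrix.GeneralLinearGroup.mkOfDetNeZero]
    obtain ⟨i0, i1, i2, i3⟩ := h2
    simp only [CubicPair.conj, h1, BinaryCubic.eval_lin, BinaryCubic.dx_lin, BinaryCubic.dx_subst,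
      BinaryCubic.eval_subst, i0, i1, i2, i3]
    simp [BinaryCubic.eval, BinaryCubic.dx, BinaryCubic.dy, hq]
    rw [div_eq_iff (pow_ne_zero 2 hp)]
    constructor
    · intro h
      linear_combination M.p.c₃ * h
    · intro h
      apply mul_left_cancel₀ hp
      linear_combination h

end CubicPair

/-! ### Sharp three-transitivity of `PGL₂` -/

namespace OnePoint

variable {F : Type*} [Field F] [DecidableEq F]

lemma exists_GL_smul_eq {P Q R : OnePoint F} (hPQ : P ≠ Q) (hPR : P ≠ R) (hQR : Q ≠ R) :
    ∃ T : GL (Fin 2) F, T • (infty : OnePoint F) = P ∧ T • ((0 : F) : OnePoint F) = Q ∧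
      T • ((1 : F) : OnePoint F) = R := by
  obtain ⟨x₁, y₁, h₁, rfl⟩ := P.exists_eq_ofCoords
  obtain ⟨x₂, y₂, h₂, rfl⟩ := Q.exists_eq_ofCoords
  obtain ⟨x₃, y₃, h₃, rfl⟩ := R.exists_eq_ofCoords
  rw [Ne, ofCoords_eq_ofCoords_iff (by assumption) (by assumption)] at hPQ hPR hQR
  have hα : x₃ * y₂ - x₂ * y₃ ≠ 0 := fun h ↦ hQR (by linear_combination -h)
  have hβ : x₁ * y₃ - x₃ * y₁ ≠ 0 := fun h ↦ hPR (by linear_combination h)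
  have hγ : x₁ * y₂ - x₂ * y₁ ≠ 0 := fun h ↦ hPQ (by linear_combination h)
  -- The columns represent `P` and `Q`, scaled by Cramer's rule so that their sum is a multiple of
  -- the vector representing `R`. The determinant is the product of the three nonzero minors.
  let T : GL (Fin 2) F := Matrix.GeneralLinearGroup.mkOfDetNeZero
    !![(x₃ * y₂ - x₂ * y₃) * x₁, (x₁ * y₃ - x₃ * y₁) * x₂;
      (x₃ * y₂ - x₂ * y₃) * y₁, (x₁ * y₃ - x₃ * y₁) * y₂] (by
    rw [Matrix.det_fin_two_of]
    convert mul_ne_zero (mul_ne_zero hα hβ) hγ using 1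
    ring)
  have t00 : T 0 0 = (x₃ * y₂ - x₂ * y₃) * x₁ := rfl
  have t01 : T 0 1 = (x₁ * y₃ - x₃ * y₁) * x₂ := rfl
  have t10 : T 1 0 = (x₃ * y₂ - x₂ * y₃) * y₁ := rfl
  have t11 : T 1 1 = (x₁ * y₃ - x₃ * y₁) * y₂ := rfl
  refine ⟨T, ?_, ?_, ?_⟩
  · rw [← ofCoords_zero 1, smul_ofCoords _ (by simp), t00, t01, t10, t11,
      ofCoords_eq_ofCoords_iff (by simpa [hα] using h₁) h₁]
    ring
  · rw [← ofCoords_one 0, smul_ofCoords _ (by simp), t00, t01, t10, t11,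
      ofCoords_eq_ofCoords_iff (by simpa [hβ] using h₂) h₂]
    ring
  · have e1 : (x₃ * y₂ - x₂ * y₃) * x₁ + (x₁ * y₃ - x₃ * y₁) * x₂ =
      (x₁ * y₂ - x₂ * y₁) * x₃ := by ring
    have e2 : (x₃ * y₂ - x₂ * y₃) * y₁ + (x₁ * y₃ - x₃ * y₁) * y₂ =
      (x₁ * y₂ - x₂ * y₁) * y₃ := by ring
    rw [← ofCoords_one 1, smul_ofCoords _ (by simp), t00, t01, t10, t11, mul_one, mul_one, mul_one,
      mul_one, e1, e2, ofCoords_eq_ofCoords_iff (by simpa [hγ] using h₃) h₃]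
    ring

lemma exists_GL_smul_eq_three {P Q R P' Q' R' : OnePoint F} (hPQ : P ≠ Q) (hPR : P ≠ R)
    (hQR : Q ≠ R) (hPQ' : P' ≠ Q') (hPR' : P' ≠ R') (hQR' : Q' ≠ R') :
    ∃ T : GL (Fin 2) F, T • P = P' ∧ T • Q = Q' ∧ T • R = R' := by
  obtain ⟨T, h1, h2, h3⟩ := exists_GL_smul_eq hPQ hPR hQR
  obtain ⟨S, g1, g2, g3⟩ := exists_GL_smul_eq hPQ' hPR' hQR'
  refine ⟨S * T⁻¹, ?_, ?_, ?_⟩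
  · rw [mul_smul, ← h1, inv_smul_smul, g1]
  · rw [mul_smul, ← h2, inv_smul_smul, g2]
  · rw [mul_smul, ← h3, inv_smul_smul, g3]

/-- Conjugation moves the three points to `∞, 0, 1`. Fixing `∞` and `0` makes the matrix diagonal,
and fixing `1` makes it scalar. -/
lemma mk_eq_one_of_smul_eq_self {A : GL (Fin 2) F} {P Q R : OnePoint F} (hPQ : P ≠ Q)
    (hPR : P ≠ R) (hQR : Q ≠ R) (hP : A • P = P) (hQ : A • Q = Q) (hR : A • R = R) :
    Matrix.ProjGenLinGroup.mk A = 1 := by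
  obtain ⟨T, h1, h2, h3⟩ := exists_GL_smul_eq hPQ hPR hQR
  have hB : A = T * (T⁻¹ * A * T) * T⁻¹ := by group
  rw [← h1] at hP
  rw [← h2] at hQ
  rw [← h3] at hR
  generalize hB' : T⁻¹ * A * T = B at hB
  have k1 : B • (infty : OnePoint F) = infty := by
    rw [← hB', mul_smul, mul_smul, hP, inv_smul_smul]
  have k2 : B • ((0 : F) : OnePoint F) = (0 : F) := by
    rw [← hB', mul_smul, mul_smul, hQ, inv_smul_smul]
  have k3 : B • ((1 : F) : OnePoint F) = (1 : F) := by
    rw [← hB', mul_smul, mul_smul, hR, inv_smul_smul]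
  rw [smul_infty_eq_self_iff] at k1
  rw [← ofCoords_one, smul_ofCoords _ (by simp)] at k2 k3
  rw [ofCoords_eq_ofCoords_iff (by
    by_contra! ⟨e1, e2⟩
    apply B.det_ne_zero
    rw [Matrix.det_fin_two]
    simp at e1 e2
    simp [e1, e2]) (by simp)] at k2
  rw [ofCoords_eq_ofCoords_iff (by
    by_contra! ⟨e1, e2⟩
    apply B.det_ne_zero
    rw [Matrix.det_fin_two]
    linear_combination B 1 1 * e1 - B 0 1 * e2) (by simp)] at k3
  have h01 : B 0 1 = 0 := by linear_combination k2
  have h00 : B 0 0 = B 1 1 := by linear_combination k3 - h01 + k1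
  have hd : B 1 1 ≠ 0 := by
    intro h
    apply B.det_ne_zero
    rw [Matrix.det_fin_two, h01, h]
    simp
  have hs : B = Matrix.GeneralLinearGroup.scalar (Fin 2) (Units.mk0 _ hd) := by
    ext i j
    fin_cases i <;> fin_cases j <;> simp [k1, h01, h00, Matrix.scalar_apply]
  have : Matrix.ProjGenLinGroup.mk B = 1 := by
    rw [hs, Matrix.ProjGenLinGroup.mk_scalar]
  rw [hB, map_mul, map_mul, this, mul_one, ← map_mul, mul_inv_cancel, map_one]

lemma mk_eq_mk_of_smul_eq {A B : GL (Fin 2) F} {P Q R : OnePoint F} (hPQ : P ≠ Q)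
    (hPR : P ≠ R) (hQR : Q ≠ R) (hP : A • P = B • P) (hQ : A • Q = B • Q) (hR : A • R = B • R) :
    Matrix.ProjGenLinGroup.mk A = Matrix.ProjGenLinGroup.mk B := by
  have := mk_eq_one_of_smul_eq_self (A := B⁻¹ * A) hPQ hPR hQR
    (by rw [mul_smul, hP, inv_smul_smul]) (by rw [mul_smul, hQ, inv_smul_smul])
    (by rw [mul_smul, hR, inv_smul_smul])
  rw [map_mul, map_inv, inv_mul_eq_one] at this
  exact this.symm

end OnePoint

/-! ### Counting fixed points -/

namespace CubicPair

open Polynomial P1Map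

variable {F : Type*} [Field F]

/-- The polynomial whose roots are the finite fixed points. -/
noncomputable def fixPoly (M : CubicPair F) : F[X] := X * M.q.toPoly - M.p.toPoly

lemma natDegree_fixPoly_le (M : CubicPair F) : M.fixPoly.natDegree ≤ 4 := by
  unfold fixPoly BinaryCubic.toPoly
  compute_degree

lemma natDegree_fixPoly_le_of_eq_zero {M : CubicPair F} (h : M.q.c₃ = 0) :
    M.fixPoly.natDegree ≤ 3 := by
  unfold fixPoly BinaryCubic.toPoly
  rw [h, C_0, zero_mul, zero_add]
  compute_degree

lemma fixPoly_map {L : Type*} [Field L] (φ : F →+* L) (M : CubicPair F) :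
    (M.map φ).fixPoly = M.fixPoly.map φ := by
  simp [fixPoly, map, BinaryCubic.toPoly_map]

section

variable [IsAlgClosed F]

/-- If `p = X q`, comparing degrees gives `q.c₃ = 0`. Nondegeneracy at infinity then makes `q`
quadratic, and a root of `q` is a common zero. -/
lemma Nondegenerate.fixPoly_ne_zero {M : CubicPair F} (hM : M.Nondegenerate) : M.fixPoly ≠ 0 := by
  intro h
  obtain ⟨p0, p1, p2, p3⟩ := M.p.coeff_toPoly
  obtain ⟨q0, q1, q2, q3⟩ := M.q.coeff_toPoly
  have hp : M.p.toPoly = X * M.q.toPoly := (sub_eq_zero.1 h).symm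
  have hq3 : M.q.c₃ = 0 := by
    have := congrArg (coeff · 4) hp
    simp only [coeff_X_mul] at this
    rw [← q3, ← this]
    exact coeff_eq_zero_of_natDegree_lt (lt_of_le_of_lt M.p.natDegree_toPoly_le (by norm_num))
  rw [hp] at p0 p1 p2 p3
  simp only [coeff_X_mul, coeff_X_mul_zero] at p0 p1 p2 p3
  have hq2 : M.q.c₂ ≠ 0 := by
    intro h0
    have := hM 1 0 (by simp [BinaryCubic.eval, ← p3, q2, h0]) (by simp [BinaryCubic.eval, hq3])
    simp at this
  have hq : M.q.toPoly = C M.q.c₂ * X ^ 2 + C M.q.c₁ * X + C M.q.c₀ := by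
    simp [BinaryCubic.toPoly, hq3]
  obtain ⟨x, hx⟩ := IsAlgClosed.exists_root M.q.toPoly (fun h0 ↦ by
    simpa [hq, natDegree_quadratic hq2] using natDegree_eq_of_degree_eq_some h0)
  have hx' : M.p.toPoly.eval x = 0 := by
    rw [hp, eval_mul, hx.eq_zero, mul_zero]
  rw [IsRoot, BinaryCubic.eval_toPoly] at hx
  rw [BinaryCubic.eval_toPoly] at hx'
  simpa using (hM x 1 hx' hx).2

lemma Nondegenerate.mem_roots_fixPoly {M : CubicPair F} (hM : M.Nondegenerate) {x : F}
    (hx : (x : OnePoint F) ∈ fixedPoints M.toRatFunc) : x ∈ M.fixPoly.roots := by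
  rw [mem_roots hM.fixPoly_ne_zero, IsRoot, fixPoly, eval_sub, eval_mul, eval_X,
    BinaryCubic.eval_toPoly, BinaryCubic.eval_toPoly]
  have := ((hM.value_coe x x).1 hx).2
  linear_combination -this

/-- The number `e` accounts for `∞`: when `∞` is fixed, the degree of `fixPoly` drops by at least
one from four. -/
lemma Nondegenerate.encard_fixedPoints_le [DecidableEq F] {M : CubicPair F}
    (hM : M.Nondegenerate) : ∃ e : ℕ, M.fixPoly.natDegree + e ≤ 4 ∧
      (fixedPoints M.toRatFunc).encard ≤ (M.fixPoly.roots.toFinset.card + e : ℕ) := by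
  have key : fixedPoints M.toRatFunc \ {OnePoint.infty} ⊆
      ((↑) : F → OnePoint F) '' (M.fixPoly.roots.toFinset : Set F) := by
    rintro P ⟨hP, hP'⟩
    induction P using OnePoint.rec with
    | infty => simp at hP'
    | coe x => exact ⟨x, by simpa using hM.mem_roots_fixPoly hP, rfl⟩
  have h1 := (Set.encard_le_encard key).trans (Set.encard_image_le _ _)
  rw [Set.encard_coe_eq_coe_finsetCard] at h1
  by_cases h : (OnePoint.infty : OnePoint F) ∈ fixedPoints M.toRatFunc
  · refine ⟨1, by have := natDegree_fixPoly_le_of_eq_zero (hM.value_infty.1 h).2; omega, ?_⟩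
    rw [← Set.encard_sdiff_singleton_add_one h]
    push_cast
    gcongr
  · refine ⟨0, by simpa using M.natDegree_fixPoly_le, ?_⟩
    rwa [Set.sdiff_singleton_eq_self h] at h1

lemma Nondegenerate.encard_fixedPoints_le_four {M : CubicPair F} (hM : M.Nondegenerate) :
    (fixedPoints M.toRatFunc).encard ≤ 4 := by
  classical
  obtain ⟨e, h1, h2⟩ := hM.encard_fixedPoints_le
  refine h2.trans ?_
  have := M.fixPoly.roots.toFinset_card_le
  have := M.fixPoly.card_roots'
  exact_mod_cast (by omega : M.fixPoly.roots.toFinset.card + e ≤ 4)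

/-- With four fixed points the degree bound leaves no room for a repeated root. -/
lemma Nondegenerate.separable_fixPoly {M : CubicPair F} (hM : M.Nondegenerate)
    (h4 : (fixedPoints M.toRatFunc).encard = 4) : M.fixPoly.Separable := by
  classical
  obtain ⟨e, h1, h2⟩ := hM.encard_fixedPoints_le
  rw [h4] at h2
  have h3 : 4 ≤ M.fixPoly.roots.toFinset.card + e := by exact_mod_cast h2
  have := M.fixPoly.roots.toFinset_card_le
  have := M.fixPoly.card_roots'
  rw [← nodup_roots_iff_of_splits hM.fixPoly_ne_zero (IsAlgClosed.splits _),
    ← Multiset.toFinset_card_eq_card_iff_nodup]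
  omega

end

end CubicPair

/-! ### Base change and fields of definition -/

namespace P1Map

open Polynomial

variable {K F : Type*} [Field K] [Field F] [Algebra K F]

lemma baseChange_div (p : K[X]) {q : K[X]} (hq : q ≠ 0) :
    baseChange F (algebraMap K[X] (RatFunc K) p / algebraMap K[X] (RatFunc K) q) =
      algebraMap F[X] (RatFunc F) (p.map (algebraMap K F)) /
        algebraMap F[X] (RatFunc F) (q.map (algebraMap K F)) := by
  set f := algebraMap K[X] (RatFunc K) p / algebraMap K[X] (RatFunc K) q
  have h1 : f.num * q = p * f.denom := RatFunc.num_div_mul p hq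
  rw [baseChange, div_eq_div_iff, ← map_mul, ← map_mul, ← Polynomial.map_mul, h1,
    Polynomial.map_mul]
  · exact RatFunc.algebraMap_ne_zero
      ((Polynomial.map_ne_zero_iff (algebraMap K F).injective).2 f.denom_ne_zero)
  · exact RatFunc.algebraMap_ne_zero
      ((Polynomial.map_ne_zero_iff (algebraMap K F).injective).2 hq)

lemma isDefinedOver_toRatFunc_map {N : CubicPair K}
    (hN : N.q.toPoly ≠ 0) : IsDefinedOver K (N.map (algebraMap K F)).toRatFunc := by
  refine ⟨N.toRatFunc, ?_⟩
  rw [CubicPair.toRatFunc, baseChange_div _ hN, CubicPair.toRatFunc, CubicPair.map,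
    BinaryCubic.toPoly_map, BinaryCubic.toPoly_map]

/-- The binary cubic form with the coefficients of a polynomial of degree at most three. -/
def _root_.BinaryCubic.ofPoly (p : K[X]) : BinaryCubic K :=
  ⟨p.coeff 0, p.coeff 1, p.coeff 2, p.coeff 3⟩

lemma _root_.BinaryCubic.toPoly_ofPoly {p : K[X]} (h : p.natDegree ≤ 3) :
    (BinaryCubic.ofPoly p).toPoly = p := by
  conv_rhs => rw [as_sum_range_C_mul_X_pow' p (n := 4) (by omega)]
  simp [Finset.sum_range_succ, BinaryCubic.ofPoly, BinaryCubic.toPoly]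
  ring

/-- There is no common zero at infinity because numerator or denominator has degree exactly three,
and none at a finite point because the Bézout relation survives base change. -/
lemma exists_cubicPair {f : RatFunc K} (hdeg : degree f = 3) :
    ∃ M : CubicPair K, (M.map (algebraMap K F)).Nondegenerate ∧
      baseChange F f = (M.map (algebraMap K F)).toRatFunc := by
  have hn : f.num.natDegree ≤ 3 := hdeg ▸ le_max_left _ _
  have hd : f.denom.natDegree ≤ 3 := hdeg ▸ le_max_right _ _
  refine ⟨⟨.ofPoly f.num, .ofPoly f.denom⟩, ?_, ?_⟩
  · intro x y hp hq
    simp only [CubicPair.map] at hp hq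
    by_cases hy : y = 0
    · subst hy
      refine ⟨?_, rfl⟩
      by_contra hx
      simp [BinaryCubic.eval, BinaryCubic.map, hx, BinaryCubic.ofPoly] at hp hq
      have h1 : f.num.natDegree ≠ 3 := by
        intro h
        rw [← h, coeff_natDegree, leadingCoeff_eq_zero] at hp
        rw [hp] at h
        simp at h
      have h2 : f.denom.natDegree ≠ 3 := by
        intro h
        rw [← h, coeff_natDegree, leadingCoeff_eq_zero] at hq
        exact f.denom_ne_zero hq
      unfold degree at hdeg
      omega
    · exfalso
      have key (p : BinaryCubic F) (h : p.eval x y = 0) : p.toPoly.eval (x / y) = 0 := by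
        have := p.eval_smul y (x / y) 1
        rw [mul_div_cancel₀ _ hy, mul_one, h] at this
        rw [BinaryCubic.eval_toPoly]
        simpa [hy] using this.symm
      have h1 := key _ hp
      have h2 := key _ hq
      rw [BinaryCubic.toPoly_map, BinaryCubic.toPoly_ofPoly (by assumption)] at h1 h2
      obtain ⟨a, b, hab⟩ := f.isCoprime_num_denom.map (Polynomial.mapRingHom (algebraMap K F))
      have := congrArg (Polynomial.eval (x / y)) hab
      simp [h1, h2] at this
  · rw [baseChange, CubicPair.toRatFunc, CubicPair.map, BinaryCubic.toPoly_map,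
      BinaryCubic.toPoly_map, BinaryCubic.toPoly_ofPoly hn, BinaryCubic.toPoly_ofPoly hd]

end P1Map

/-! ### Multiplier form under conjugation -/

namespace OnePoint

variable {F : Type*} [Field F] [DecidableEq F]

lemma smul_eq_of_mk_eq {A B : GL (Fin 2) F}
    (h : Matrix.ProjGenLinGroup.mk A = Matrix.ProjGenLinGroup.mk B) (P : OnePoint F) :
    A • P = B • P := by
  obtain ⟨u, rfl⟩ := Matrix.ProjGenLinGroup.mk_eq_mk_iff.1 h
  obtain ⟨x, y, hxy, rfl⟩ := P.exists_eq_ofCoords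
  rw [mul_smul, smul_ofCoords (.scalar (Fin 2) u) hxy]
  have : ofCoords ((Matrix.GeneralLinearGroup.scalar (Fin 2) u) 0 0 * x +
      (Matrix.GeneralLinearGroup.scalar (Fin 2) u) 0 1 * y)
      ((Matrix.GeneralLinearGroup.scalar (Fin 2) u) 1 0 * x +
      (Matrix.GeneralLinearGroup.scalar (Fin 2) u) 1 1 * y) = ofCoords x y := by
    rw [ofCoords_eq_ofCoords_iff (by simpa [Matrix.scalar_apply] using hxy) hxy]
    simp [Matrix.scalar_apply]
    ring
  rw [this]

end OnePoint

namespace CubicPair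

open P1Map

variable {F : Type*} [Field F] [IsAlgClosed F] {M : CubicPair F}

lemma Nondegenerate.conj_toRatFunc (hM : M.Nondegenerate) (A : GL (Fin 2) F) :
    P1Map.conj (Matrix.ProjGenLinGroup.mk A) M.toRatFunc = (M.conj A).toRatFunc := by
  rw [conj_mk, hM.conjGL_toRatFunc]

variable [DecidableEq F]

lemma Nondegenerate.mem_fixedPoints_conj_iff (hM : M.Nondegenerate) (A : GL (Fin 2) F)
    (P : OnePoint F) :
    P ∈ fixedPoints (M.conj A).toRatFunc ↔ A • P ∈ fixedPoints M.toRatFunc := by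
  have h1 {l} := (hM.conj A).hasMultiplier_iff (P := P) (l := l)
  have h2 {l} := hM.hasMultiplier_iff (P := A • P) (l := l)
  constructor
  · intro h
    exact (h2.1 (hasMultiplier_conj_iff.1 (h1.2 ⟨h, rfl⟩))).1
  · intro h
    exact (h1.1 (hasMultiplier_conj_iff.2 (h2.2 ⟨h, rfl⟩))).1

lemma Nondegenerate.multiplier_conj (hM : M.Nondegenerate) (A : GL (Fin 2) F)
    {P : OnePoint F} (h : A • P ∈ fixedPoints M.toRatFunc) :
    multiplier (M.conj A).toRatFunc P = multiplier M.toRatFunc (A • P) :=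
  ((hM.conj A).hasMultiplier_iff.1 (hasMultiplier_conj_iff.2 (hM.hasMultiplier_iff.2 ⟨h, rfl⟩))).2

lemma Nondegenerate.image_fixedPoints_conj (hM : M.Nondegenerate) (A : GL (Fin 2) F) :
    (A • ·) '' fixedPoints (M.conj A).toRatFunc = fixedPoints M.toRatFunc := by
  ext P
  constructor
  · rintro ⟨Q, hQ, rfl⟩
    exact (hM.mem_fixedPoints_conj_iff A Q).1 hQ
  · intro hP
    refine ⟨A⁻¹ • P, (hM.mem_fixedPoints_conj_iff A _).2 ?_, smul_inv_smul A P⟩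
    rwa [smul_inv_smul]

/-- A fixed point `Q` of the conjugate corresponds to `P = A • Q` with the same multiplier, so `Q =
λ(Q)` becomes `P = A • λ(P)`. Three fixed points rule out the first alternative of the definition.
-/
lemma Nondegenerate.isPartialFixedPointMultiplierForm_conj_iff (hM : M.Nondegenerate)
    (h3 : 3 ≤ (fixedPoints M.toRatFunc).encard) (A : GL (Fin 2) F) :
    IsPartialFixedPointMultiplierForm
        (P1Map.conj (Matrix.ProjGenLinGroup.mk A) M.toRatFunc) ↔
      (fixedPoints M.toRatFunc).encard = 4 ∧
        3 ≤ {P ∈ fixedPoints M.toRatFunc |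
          P = A • ((multiplier M.toRatFunc P : F) : OnePoint F)}.encard := by
  have hc : (fixedPoints (M.conj A).toRatFunc).encard = (fixedPoints M.toRatFunc).encard := by
    rw [← hM.image_fixedPoints_conj A, (MulAction.injective A).encard_image]
  have hT : {P ∈ fixedPoints M.toRatFunc |
      P = A • ((multiplier M.toRatFunc P : F) : OnePoint F)} = (A • ·) ''
      {P ∈ fixedPoints (M.conj A).toRatFunc |
        P = ((multiplier (M.conj A).toRatFunc P : F) : OnePoint F)} := by
    ext P
    constructor
    · rintro ⟨hP, hP'⟩
      have h : A • A⁻¹ • P ∈ fixedPoints M.toRatFunc := by rwa [smul_inv_smul]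
      refine ⟨A⁻¹ • P, ⟨(hM.mem_fixedPoints_conj_iff A _).2 h, ?_⟩, smul_inv_smul A P⟩
      rw [hM.multiplier_conj A h, smul_inv_smul, inv_smul_eq_iff]
      exact hP'
    · rintro ⟨Q, ⟨hQ, hQ'⟩, rfl⟩
      have h := (hM.mem_fixedPoints_conj_iff A Q).1 hQ
      refine ⟨h, ?_⟩
      rw [hM.multiplier_conj A h] at hQ'
      rw [← hQ']
  rw [hM.conj_toRatFunc, IsPartialFixedPointMultiplierForm, hc, hT,
    (MulAction.injective A).encard_image, or_iff_right]
  rintro ⟨h2, -⟩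
  have := h3.trans h2
  norm_num at this

end CubicPair

/-! ### Swap configurations and the two solutions -/

namespace P1Map

variable {F : Type*} [Field F] [DecidableEq F]

/-- The function `f` has exactly four fixed points, exactly two of which, interchanged by the
automorphism `S`, have the same multiplier. -/
structure IsSwapConfiguration (f : RatFunc F) (S : GL (Fin 2) F) (P₁ P₂ P₃ P₄ : OnePoint F) :
    Prop where
  fixedPoints_eq : fixedPoints f = {P₁, P₂, P₃, P₄}
  ne₁₂ : P₁ ≠ P₂
  multiplier_eq : multiplier f P₂ = multiplier f P₁
  ne₁₃ : multiplier f P₁ ≠ multiplier f P₃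
  ne₁₄ : multiplier f P₁ ≠ multiplier f P₄
  ne₃₄ : multiplier f P₃ ≠ multiplier f P₄
  conj_eq : conj (Matrix.ProjGenLinGroup.mk S) f = f
  smul₁ : S • P₁ = P₂
  smul₂ : S • P₂ = P₁
  smul₃ : S • P₃ = P₃
  smul₄ : S • P₄ = P₄

namespace IsSwapConfiguration

variable {f : RatFunc F} {S : GL (Fin 2) F} {P₁ P₂ P₃ P₄ : OnePoint F}

lemma symm (h : IsSwapConfiguration f S P₁ P₂ P₃ P₄) : IsSwapConfiguration f S P₂ P₁ P₃ P₄ where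
  fixedPoints_eq := by rw [h.fixedPoints_eq, Set.insert_comm]
  ne₁₂ := h.ne₁₂.symm
  multiplier_eq := h.multiplier_eq.symm
  ne₁₃ := h.multiplier_eq ▸ h.ne₁₃
  ne₁₄ := h.multiplier_eq ▸ h.ne₁₄
  ne₃₄ := h.ne₃₄
  conj_eq := h.conj_eq
  smul₁ := h.smul₂
  smul₂ := h.smul₁
  smul₃ := h.smul₃
  smul₄ := h.smul₄

lemma points_ne (h : IsSwapConfiguration f S P₁ P₂ P₃ P₄) :
    P₁ ≠ P₃ ∧ P₁ ≠ P₄ ∧ P₂ ≠ P₃ ∧ P₂ ≠ P₄ ∧ P₃ ≠ P₄ :=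
  ⟨fun e ↦ h.ne₁₃ (e ▸ rfl), fun e ↦ h.ne₁₄ (e ▸ rfl), fun e ↦ h.symm.ne₁₃ (e ▸ rfl),
    fun e ↦ h.symm.ne₁₄ (e ▸ rfl), fun e ↦ h.ne₃₄ (e ▸ rfl)⟩

lemma multipliers_ne (h : IsSwapConfiguration f S P₁ P₂ P₃ P₄) :
    ((multiplier f P₁ : F) : OnePoint F) ≠ multiplier f P₃ ∧
    ((multiplier f P₁ : F) : OnePoint F) ≠ multiplier f P₄ ∧
    ((multiplier f P₃ : F) : OnePoint F) ≠ multiplier f P₄ := by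
  simp only [Ne, OnePoint.coe_eq_coe]
  exact ⟨h.ne₁₃, h.ne₁₄, h.ne₃₄⟩

lemma encard_fixedPoints (h : IsSwapConfiguration f S P₁ P₂ P₃ P₄) :
    (fixedPoints f).encard = 4 := by
  obtain ⟨h13, h14, h23, h24, h34⟩ := h.points_ne
  rw [h.fixedPoints_eq, Set.encard_insert_of_notMem (by simp [h.ne₁₂, h13, h14]),
    Set.encard_insert_of_notMem (by simp [h23, h24]), Set.encard_pair h34]
  norm_num

end IsSwapConfiguration

end P1Map

namespace CubicPair

open P1Map

variable {F : Type*} [Field F] [IsAlgClosed F] [DecidableEq F] {M : CubicPair F}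

lemma Nondegenerate.exists_isSwapConfiguration (hM : M.Nondegenerate) {S : GL (Fin 2) F}
    (hS : P1Map.conj (Matrix.ProjGenLinGroup.mk S) M.toRatFunc = M.toRatFunc)
    (hS' : Matrix.ProjGenLinGroup.mk S ≠ 1) (h3 : 3 ≤ (multipliers M.toRatFunc).encard) :
    ∃ P₁ P₂ P₃ P₄, IsSwapConfiguration M.toRatFunc S P₁ P₂ P₃ P₄ := by
  have hS1 : (M.conj S).toRatFunc = M.toRatFunc := by rw [← hM.conj_toRatFunc, hS]
  have hmem (P) : S • P ∈ fixedPoints M.toRatFunc ↔ P ∈ fixedPoints M.toRatFunc := by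
    rw [← hM.mem_fixedPoints_conj_iff, hS1]
  have hmul {P} (hP : P ∈ fixedPoints M.toRatFunc) :
      multiplier M.toRatFunc (S • P) = multiplier M.toRatFunc P := by
    rw [← hM.multiplier_conj S ((hmem P).2 hP), hS1]
  obtain ⟨t, ht, ht3⟩ := Set.exists_subset_encard_eq h3
  obtain ⟨a, b, c, hab, hac, hbc, rfl⟩ := Set.encard_eq_three.1 ht3
  obtain ⟨A, hA, rfl⟩ := ht (show a ∈ _ by simp)
  obtain ⟨B, hB, rfl⟩ := ht (show b ∈ _ by simp)
  obtain ⟨C, hC, rfl⟩ := ht (show c ∈ _ by simp)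
  -- It suffices that `S` moves one of three fixed points with distinct multipliers: its image has
  -- the same multiplier, hence is a fourth fixed point, and there are no others.
  have key : ∀ P₁ P₃ P₄, P₁ ∈ fixedPoints M.toRatFunc → P₃ ∈ fixedPoints M.toRatFunc →
      P₄ ∈ fixedPoints M.toRatFunc → multiplier M.toRatFunc P₁ ≠ multiplier M.toRatFunc P₃ →
      multiplier M.toRatFunc P₁ ≠ multiplier M.toRatFunc P₄ →
      multiplier M.toRatFunc P₃ ≠ multiplier M.toRatFunc P₄ → S • P₁ ≠ P₁ →
      ∃ P₁ P₂ P₃ P₄, IsSwapConfiguration M.toRatFunc S P₁ P₂ P₃ P₄ := by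
    intro P₁ P₃ P₄ m1 m3 m4 n13 n14 n34 hne
    have m2 := (hmem P₁).2 m1
    have e2 := hmul m1
    have d13 : P₁ ≠ P₃ := fun e ↦ n13 (e ▸ rfl)
    have d14 : P₁ ≠ P₄ := fun e ↦ n14 (e ▸ rfl)
    have d34 : P₃ ≠ P₄ := fun e ↦ n34 (e ▸ rfl)
    have d23 : S • P₁ ≠ P₃ := fun e ↦ n13 (by rw [← e2, e])
    have d24 : S • P₁ ≠ P₄ := fun e ↦ n14 (by rw [← e2, e])
    have hcard : ({P₁, S • P₁, P₃, P₄} : Set (OnePoint F)).encard = 4 := by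
      rw [Set.encard_insert_of_notMem (by simp [hne.symm, d13, d14]),
        Set.encard_insert_of_notMem (by simp [d23, d24]), Set.encard_pair d34]
      norm_num
    have hfix : {P₁, S • P₁, P₃, P₄} = fixedPoints M.toRatFunc := by
      apply Set.Finite.eq_of_subset_of_encard_le
      · simp
      · rintro P (rfl | rfl | rfl | rfl) <;> assumption
      · rw [hcard]
        exact hM.encard_fixedPoints_le_four
    have cases4 {P} (hP : P ∈ fixedPoints M.toRatFunc) :
        S • P = P₁ ∨ S • P = S • P₁ ∨ S • P = P₃ ∨ S • P = P₄ := by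
      have := (hmem P).2 hP
      rwa [← hfix] at this
    refine ⟨P₁, S • P₁, P₃, P₄, hfix.symm, hne.symm, e2, n13, n14, n34, hS, rfl, ?_, ?_, ?_⟩
    · rcases cases4 m2 with h | h | h | h
      · exact h
      · exact absurd (smul_left_cancel S h) hne
      · exact absurd (by rw [← e2, ← hmul m2, h]) n13
      · exact absurd (by rw [← e2, ← hmul m2, h]) n14
    · have e3 := hmul m3
      rcases cases4 m3 with h | h | h | h
      · exact absurd (by rw [← e3, h]) n13
      · exact absurd (by rw [← e3, h, e2]) n13
      · exact h
      · exact absurd (by rw [← e3, h]) n34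
    · have e4 := hmul m4
      rcases cases4 m4 with h | h | h | h
      · exact absurd (by rw [← e4, h]) n14
      · exact absurd (by rw [← e4, h, e2]) n14
      · exact absurd (by rw [← e4, h]) n34
      · exact h
  by_cases h1 : S • A = A
  · by_cases h2 : S • B = B
    · by_cases h4 : S • C = C
      · exact absurd (OnePoint.mk_eq_one_of_smul_eq_self (ne_of_apply_ne _ hab)
          (ne_of_apply_ne _ hac) (ne_of_apply_ne _ hbc) h1 h2 h4) hS'
      · exact key C A B hC hA hB hac.symm hbc.symm hab h4
    · exact key B A C hB hA hC hab.symm hbc hac h2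
  · exact key A B C hA hB hC hab hac hbc h1

end CubicPair

namespace P1Map.IsSwapConfiguration

variable {F : Type*} [Field F] [IsAlgClosed F] [DecidableEq F] {M : CubicPair F}
  {S : GL (Fin 2) F} {P₁ P₂ P₃ P₄ : OnePoint F}

lemma isPartialFixedPointMultiplierForm_conj_iff
    (h : IsSwapConfiguration M.toRatFunc S P₁ P₂ P₃ P₄) (hM : M.Nondegenerate)
    (A : GL (Fin 2) F) :
    IsPartialFixedPointMultiplierForm (conj (Matrix.ProjGenLinGroup.mk A) M.toRatFunc) ↔
      (A • ((multiplier M.toRatFunc P₁ : F) : OnePoint F) = P₁ ∨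
        A • ((multiplier M.toRatFunc P₁ : F) : OnePoint F) = P₂) ∧
      A • ((multiplier M.toRatFunc P₃ : F) : OnePoint F) = P₃ ∧
      A • ((multiplier M.toRatFunc P₄ : F) : OnePoint F) = P₄ := by
  obtain ⟨h13, h14, h23, h24, h34⟩ := h.points_ne
  rw [hM.isPartialFixedPointMultiplierForm_conj_iff
    (by rw [h.encard_fixedPoints]; norm_num), h.encard_fixedPoints]
  simp only [true_and]
  constructor
  · intro hT
    rw [h.fixedPoints_eq] at hT
    -- Among at least three matching points, one avoids any two prescribed points.
    have key (X Y : OnePoint F) : ∃ P, (P = P₁ ∨ P = P₂ ∨ P = P₃ ∨ P = P₄) ∧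
        P = A • ((multiplier M.toRatFunc P : F) : OnePoint F) ∧ P ≠ X ∧ P ≠ Y := by
      by_contra! hno
      have hsub : {P ∈ ({P₁, P₂, P₃, P₄} : Set (OnePoint F)) |
          P = A • ((multiplier M.toRatFunc P : F) : OnePoint F)} ⊆ {X, Y} := by
        rintro P ⟨hP, hP'⟩
        by_cases hX : P = X
        · simp [hX]
        · simp [hno P hP hP' hX]
      have := hT.trans ((Set.encard_le_encard hsub).trans ((Set.encard_insert_le {Y} X).trans (by rw [Set.encard_singleton])))
      norm_num at this
    have h12 := h.ne₁₂
    have he := h.multiplier_eq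
    have key' (X Y : OnePoint F) :
        (P₁ = A • ((multiplier M.toRatFunc P₁ : F) : OnePoint F) ∧ P₁ ≠ X ∧ P₁ ≠ Y) ∨
        (P₂ = A • ((multiplier M.toRatFunc P₁ : F) : OnePoint F) ∧ P₂ ≠ X ∧ P₂ ≠ Y) ∨
        (P₃ = A • ((multiplier M.toRatFunc P₃ : F) : OnePoint F) ∧ P₃ ≠ X ∧ P₃ ≠ Y) ∨
        (P₄ = A • ((multiplier M.toRatFunc P₄ : F) : OnePoint F) ∧ P₄ ≠ X ∧ P₄ ≠ Y) := by
      obtain ⟨P, rfl | rfl | rfl | rfl, hP⟩ := key X Y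
      · tauto
      · rw [he] at hP; tauto
      · tauto
      · tauto
    -- The first instance matches `P₁` or `P₂`. If `P₃` (or `P₄`) failed to match, two of the others
    -- would force both `P₁` and `P₂` to equal `A • λ(P₁)`, although they are distinct.
    have k12 := key' P₃ P₄
    have k23 := key' P₁ P₄
    have k13 := key' P₂ P₄
    have k24 := key' P₁ P₃
    have k14 := key' P₂ P₃
    grind
  · rintro ⟨h1, h3, h4⟩
    have hP {P} : P = P₁ ∨ P = P₂ ∨ P = P₃ ∨ P = P₄ → P ∈ fixedPoints M.toRatFunc := by
      rw [h.fixedPoints_eq]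
      exact id
    rcases h1 with h1 | h1
    · rw [← Set.encard_eq_three.2 ⟨P₁, P₃, P₄, h13, h14, h34, rfl⟩]
      apply Set.encard_le_encard
      rintro P (rfl | rfl | rfl)
      · exact ⟨hP (by simp), h1.symm⟩
      · exact ⟨hP (by simp), h3.symm⟩
      · exact ⟨hP (by simp), h4.symm⟩
    · rw [← Set.encard_eq_three.2 ⟨P₂, P₃, P₄, h23, h24, h34, rfl⟩]
      apply Set.encard_le_encard
      rintro P (rfl | rfl | rfl)
      · exact ⟨hP (by simp), by rw [h.multiplier_eq, h1]⟩
      · exact ⟨hP (by simp), h3.symm⟩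
      · exact ⟨hP (by simp), h4.symm⟩

/-- Choose `A` matching `P₁, P₃, P₄`; then `S * A` matches `P₂, P₃, P₄`. Every solution agrees with
one of them at three distinct multipliers. -/
lemma exists_setOf_eq_pair (h : IsSwapConfiguration M.toRatFunc S P₁ P₂ P₃ P₄)
    (hM : M.Nondegenerate) :
    ∃ A : GL (Fin 2) F, A • ((multiplier M.toRatFunc P₁ : F) : OnePoint F) = P₁ ∧
      Matrix.ProjGenLinGroup.mk A ≠ Matrix.ProjGenLinGroup.mk (S * A) ∧
      {ρ : PGL(2, F) | IsPartialFixedPointMultiplierForm (conj ρ M.toRatFunc)} =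
        {Matrix.ProjGenLinGroup.mk A, Matrix.ProjGenLinGroup.mk (S * A)} := by
  obtain ⟨h13, h14, h23, h24, h34⟩ := h.points_ne
  obtain ⟨g13, g14, g34⟩ := h.multipliers_ne
  obtain ⟨A, hA1, hA3, hA4⟩ := OnePoint.exists_GL_smul_eq_three g13 g14 g34 h13 h14 h34
  refine ⟨A, hA1, ?_, ?_⟩
  · intro e
    apply h.ne₁₂
    rw [← h.smul₁, ← hA1, ← mul_smul]
    exact OnePoint.smul_eq_of_mk_eq e _
  · ext ρ
    induction ρ using Matrix.ProjGenLinGroup.induction_on with | mk B => ?_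
    rw [Set.mem_ofPred_eq, h.isPartialFixedPointMultiplierForm_conj_iff hM]
    constructor
    · rintro ⟨h1 | h1, h3, h4⟩
      · left
        exact OnePoint.mk_eq_mk_of_smul_eq g13 g14 g34 (by rw [h1, hA1]) (by rw [h3, hA3])
          (by rw [h4, hA4])
      · right
        exact OnePoint.mk_eq_mk_of_smul_eq g13 g14 g34 (by rw [h1, mul_smul, hA1, h.smul₁])
          (by rw [h3, mul_smul, hA3, h.smul₃]) (by rw [h4, mul_smul, hA4, h.smul₄])
    · rintro (e | e)
      · exact ⟨.inl (by rw [OnePoint.smul_eq_of_mk_eq e, hA1]),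
          by rw [OnePoint.smul_eq_of_mk_eq e, hA3], by rw [OnePoint.smul_eq_of_mk_eq e, hA4]⟩
      · exact ⟨.inr (by rw [OnePoint.smul_eq_of_mk_eq e, mul_smul, hA1, h.smul₁]),
          by rw [OnePoint.smul_eq_of_mk_eq e, mul_smul, hA3, h.smul₃],
          by rw [OnePoint.smul_eq_of_mk_eq e, mul_smul, hA4, h.smul₄]⟩

end P1Map.IsSwapConfiguration

/-! ### Small elementary abelian 2-groups and Galois descent -/

lemma nonempty_mulEquiv_of_mul_self_eq_one {G : Type*} [Group G] [Finite G]
    (h : ∀ g : G, g * g = 1) (h4 : Nat.card G ≤ 4) :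
    Nonempty (G ≃* Unit) ∨ Nonempty (G ≃* Multiplicative (ZMod 2)) ∨
      Nonempty (G ≃* Multiplicative (ZMod 2) × Multiplicative (ZMod 2)) := by
  have hp : IsPGroup 2 G := fun g ↦ ⟨1, by rw [pow_one, pow_two, h]⟩
  obtain ⟨n, hn⟩ := IsPGroup.iff_card.1 hp
  have hn2 : n ≤ 2 := by
    by_contra! h3
    have := Nat.pow_le_pow_right (show 0 < 2 by norm_num) h3
    omega
  interval_cases n
  · left
    have := (Nat.card_eq_one_iff_unique.1 hn).1
    let _ : Unique G := ⟨⟨1⟩, fun _ ↦ Subsingleton.elim _ _⟩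
    exact ⟨MulEquiv.ofUnique⟩
  · right; left
    exact ⟨mulEquivOfPrimeCardEq (p := 2) (by simpa using hn) (by simp)⟩
  · right; right
    have hG : IsKleinFour G := by
      refine ⟨by simpa using hn, ?_⟩
      have : Nontrivial G := by
        rw [← Finite.one_lt_card_iff_nontrivial, hn]
        norm_num
      rw [Monoid.exponent_eq_prime_iff Nat.prime_two]
      exact fun g hg ↦ orderOf_eq_prime (by rw [pow_two, h]) hg
    have hV : IsKleinFour (Multiplicative (ZMod 2) × Multiplicative (ZMod 2)) :=
      ⟨by simp, by simp [Monoid.exponent_prod]⟩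
    exact IsKleinFour.nonempty_mulEquiv

/-- In a normal extension the automorphisms reach every conjugate, and a separable element outside
`K` has a conjugate other than itself. -/
lemma IsSeparable.mem_range_of_forall_algEquiv {K F : Type*} [Field K] [Field F] [Algebra K F]
    [Normal K F] {x : F} (hx : IsSeparable K x) (h : ∀ τ : F ≃ₐ[K] F, τ x = x) :
    x ∈ (algebraMap K F).range := by
  by_contra hn
  obtain ⟨y, hne, hy⟩ := (notMem_iff_exists_ne_and_isConjRoot hx (Normal.splits' x)).1 hn
  obtain ⟨τ, rfl⟩ := isConjRoot_iff_exists_algEquiv.1 hy.symm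
  exact hne (h τ).symm

namespace CubicPair

open Polynomial P1Map

/-- The multiplier is a rational expression in the coefficients and the coordinate of the point, so
it stays in the smaller field. -/
lemma HasMultiplier.of_map {E F : Type*} [Field E] [Field F] [DecidableEq E] [DecidableEq F]
    {N : CubicPair E} {φ : E →+* F} {P : OnePoint E} {l : F}
    (h : (N.map φ).HasMultiplier (P.map φ) l) : ∃ l', φ l' = l := by
  induction P using OnePoint.rec with
  | infty =>
    obtain ⟨h1, -, h3⟩ := hasMultiplier_infty_iff.1 h
    refine ⟨N.q.c₂ / N.p.c₃, ?_⟩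
    rw [map_div₀, div_eq_iff (show φ N.p.c₃ ≠ 0 from h1)]
    exact h3
  | coe x =>
    obtain ⟨h1, -, h3⟩ := hasMultiplier_coe_iff.1 h
    refine ⟨(N.p.dx x 1 - x * N.q.dx x 1) / N.q.eval x 1, ?_⟩
    simp only [CubicPair.map] at h1 h3
    rw [← _root_.map_one φ] at h1 h3
    rw [BinaryCubic.eval_map] at h1 h3
    rw [BinaryCubic.dx_map, BinaryCubic.dx_map] at h3
    rw [map_div₀, div_eq_iff h1, ← h3]
    simp

lemma conj_mul {F : Type*} [Field F] (S A : GL (Fin 2) F) (M : CubicPair F) :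
    M.conj (S * A) = (M.conj S).conj A := by
  have h1 (i j) : (S * A) i j = S i 0 * A 0 j + S i 1 * A 1 j := by
    simp [Matrix.mul_apply, Fin.sum_univ_two]
  have h2 (i j) : (S * A)⁻¹ i j = A⁻¹ i 0 * S⁻¹ 0 j + A⁻¹ i 1 * S⁻¹ 1 j := by
    rw [mul_inv_rev, Matrix.GeneralLinearGroup.coe_mul, Matrix.mul_apply, Fin.sum_univ_two]
  simp only [conj, h1, h2]
  ext <;> simp only [BinaryCubic.lin, BinaryCubic.subst, BinaryCubic.eval, BinaryCubic.dx,
    BinaryCubic.dy] <;> ring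

section

variable {F : Type*} [Field F] [IsAlgClosed F]

lemma Nondegenerate.conj_mul_eq {M : CubicPair F} (hM : M.Nondegenerate) {S : GL (Fin 2) F}
    (hS : P1Map.conj (Matrix.ProjGenLinGroup.mk S) M.toRatFunc = M.toRatFunc) (A : GL (Fin 2) F) :
    P1Map.conj (Matrix.ProjGenLinGroup.mk (S * A)) M.toRatFunc =
      P1Map.conj (Matrix.ProjGenLinGroup.mk A) M.toRatFunc := by
  rw [hM.conj_toRatFunc, conj_mul, ← (hM.conj S).conj_toRatFunc, ← hM.conj_toRatFunc, hS]

end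

variable {K F : Type*} [Field K] [Field F] [Algebra K F]

lemma map_algebraMap_map (N : CubicPair K) (τ : F ≃ₐ[K] F) :
    (N.map (algebraMap K F)).map (τ : F →+* F) = N.map (algebraMap K F) := by
  simp only [map, BinaryCubic.map_map]
  have : (τ : F →+* F).comp (algebraMap K F) = algebraMap K F := by
    ext x
    simp
  rw [this]

lemma toRatFunc_eq_of_coeff {M N : CubicPair F} {s : F} (hs : s ≠ 0)
    (hp : N.p.toPoly = C s * M.p.toPoly) (hq : N.q.toPoly = C s * M.q.toPoly) :
    N.toRatFunc = M.toRatFunc := by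
  rw [toRatFunc, hp, hq, map_mul, map_mul, mul_div_mul_left]
  · rfl
  · exact RatFunc.algebraMap_ne_zero (by simpa using hs)

lemma _root_.BinaryCubic.exists_map_toPoly_eq {p : BinaryCubic F} {s : F}
    (h : ∀ i, s * p.toPoly.coeff i ∈ (algebraMap K F).range) :
    ∃ p' : BinaryCubic K, (p'.map (algebraMap K F)).toPoly = C s * p.toPoly := by
  choose a ha using h
  refine ⟨⟨a 0, a 1, a 2, a 3⟩, ?_⟩
  obtain ⟨h0, h1, h2, h3⟩ := p.coeff_toPoly
  simp only [BinaryCubic.map, ha, h0, h1, h2, h3]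
  simp only [BinaryCubic.toPoly, map_mul]
  ring

/-- An automorphism preserving the function scales all coefficients by one common factor. Dividing
by the leading coefficient of `q` removes it, leaving Galois-fixed coefficients. Separability is
needed because fixed elements are otherwise only purely inseparable over `K`. -/
lemma Nondegenerate.isDefinedOver [IsAlgClosed F] [Normal K F] {M : CubicPair F}
    (hM : M.Nondegenerate) {N : CubicPair (separableClosure K F)}
    (hN : N.map (algebraMap _ F) = M)
    (hτ : ∀ τ : F ≃ₐ[K] F, (M.map (τ : F →+* F)).Nondegenerate ∧
      (M.map (τ : F →+* F)).toRatFunc = M.toRatFunc) :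
    IsDefinedOver K M.toRatFunc := by
  set l := M.q.toPoly.leadingCoeff
  have hl : l ≠ 0 := by simpa [l] using hM.toPoly_q_ne_zero
  have hmem : ∀ x ∈ separableClosure K F, (∀ τ : F ≃ₐ[K] F, τ x = x) →
      x ∈ (algebraMap K F).range := fun x hx ↦ hx.mem_range_of_forall_algEquiv
  have hp (i) : M.p.toPoly.coeff i ∈ separableClosure K F := by
    rw [← hN, CubicPair.map, BinaryCubic.toPoly_map, coeff_map]
    exact SetLike.coe_mem _
  have hq (i) : M.q.toPoly.coeff i ∈ separableClosure K F := by
    rw [← hN, CubicPair.map, BinaryCubic.toPoly_map, coeff_map]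
    exact SetLike.coe_mem _
  have hfix (τ : F ≃ₐ[K] F) : (∀ i, τ (l⁻¹ * M.p.toPoly.coeff i) = l⁻¹ * M.p.toPoly.coeff i) ∧
      ∀ i, τ (l⁻¹ * M.q.toPoly.coeff i) = l⁻¹ * M.q.toPoly.coeff i := by
    obtain ⟨s, hs, h1, h2⟩ := hM.exists_smul_of_toRatFunc_eq (hτ τ).1 (hτ τ).2.symm
    simp only [CubicPair.map, BinaryCubic.toPoly_map, coeff_map] at h1 h2
    have hl' : τ l = s * l := h2 _
    have h1' (i) : τ (M.p.toPoly.coeff i) = s * M.p.toPoly.coeff i := h1 i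
    have h2' (i) : τ (M.q.toPoly.coeff i) = s * M.q.toPoly.coeff i := h2 i
    constructor <;> intro i <;> rw [map_mul, map_inv₀, hl']
    · rw [h1']
      field_simp
    · rw [h2']
      field_simp
  obtain ⟨p', hp'⟩ := BinaryCubic.exists_map_toPoly_eq (p := M.p) (s := l⁻¹) fun i ↦
    hmem _ (mul_mem (inv_mem (hq _)) (hp i)) fun τ ↦ (hfix τ).1 i
  obtain ⟨q', hq'⟩ := BinaryCubic.exists_map_toPoly_eq (p := M.q) (s := l⁻¹) fun i ↦
    hmem _ (mul_mem (inv_mem (hq _)) (hq i)) fun τ ↦ (hfix τ).2 i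
  rw [← toRatFunc_eq_of_coeff (N := CubicPair.map (algebraMap K F) ⟨p', q'⟩) (inv_ne_zero hl)
    hp' hq']
  apply isDefinedOver_toRatFunc_map
  intro h
  rw [BinaryCubic.toPoly_map, h, Polynomial.map_zero] at hq'
  have := hM.toPoly_q_ne_zero
  simp [hl, this] at hq'

end CubicPair

/-! ### Galois action on the fixed points -/

namespace OnePoint

lemma map_injective_of_injective {X Y : Type*} {φ : X → Y} (h : Function.Injective φ) :
    Function.Injective (OnePoint.map φ) := Option.map_injective h

end OnePoint

namespace P1Map.IsSwapConfiguration

open CubicPair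

variable {K F : Type*} [Field K] [Field F] [IsAlgClosed F] [Algebra K F] [DecidableEq F]
  {M : CubicPair K} {S : GL (Fin 2) F} {P₁ P₂ P₃ P₄ : OnePoint F}

lemma map_mem_fixedPoints (hM : (M.map (algebraMap K F)).Nondegenerate) (τ : F ≃ₐ[K] F)
    {P : OnePoint F} (hP : P ∈ fixedPoints (M.map (algebraMap K F)).toRatFunc) :
    P.map τ ∈ fixedPoints (M.map (algebraMap K F)).toRatFunc ∧
      multiplier (M.map (algebraMap K F)).toRatFunc (P.map τ) =
        τ (multiplier (M.map (algebraMap K F)).toRatFunc P) := by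
  rw [← hM.hasMultiplier_iff]
  have := (hM.hasMultiplier_iff.2 ⟨hP, rfl⟩).map (τ : F →+* F)
  rwa [map_algebraMap_map] at this

/-- A Galois automorphism preserves the two pairs of points of the configuration. -/
lemma map_algEquiv
    (h : IsSwapConfiguration (M.map (algebraMap K F)).toRatFunc S P₁ P₂ P₃ P₄)
    (hM : (M.map (algebraMap K F)).Nondegenerate) (τ : F ≃ₐ[K] F) :
    (P₁.map τ = P₁ ∧ P₂.map τ = P₂ ∨ P₁.map τ = P₂ ∧ P₂.map τ = P₁) ∧
      (P₃.map τ = P₃ ∧ P₄.map τ = P₄ ∨ P₃.map τ = P₄ ∧ P₄.map τ = P₃) := by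
  have hinj := OnePoint.map_injective_of_injective τ.injective
  have hP {P} : P = P₁ ∨ P = P₂ ∨ P = P₃ ∨ P = P₄ →
      P ∈ fixedPoints (M.map (algebraMap K F)).toRatFunc := by
    rw [h.fixedPoints_eq]
    exact id
  have hm {P} (h0 : P = P₁ ∨ P = P₂ ∨ P = P₃ ∨ P = P₄) := map_mem_fixedPoints hM τ (hP h0)
  obtain ⟨m1, e1⟩ := hm (P := P₁) (by simp)
  obtain ⟨m2, e2⟩ := hm (P := P₂) (by simp)
  obtain ⟨m3, e3⟩ := hm (P := P₃) (by simp)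
  obtain ⟨m4, e4⟩ := hm (P := P₄) (by simp)
  obtain ⟨h13, h14, h23, h24, h34⟩ := h.points_ne
  have n12 := hinj.ne h.ne₁₂
  have n13 := hinj.ne h13
  have n14 := hinj.ne h14
  have n23 := hinj.ne h23
  have n24 := hinj.ne h24
  have n34 := hinj.ne h34
  have k2 := h.multiplier_eq
  have k13 := h.ne₁₃
  have k14 := h.ne₁₄
  have k34 := h.ne₃₄
  rw [h.fixedPoints_eq] at m1 m2 m3 m4
  simp only [Set.mem_insert_iff, Set.mem_singleton_iff] at m1 m2 m3 m4
  rw [k2, ← e1] at e2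
  clear hP hm hinj e3 e4
  generalize P₁.map τ = Q₁ at *
  generalize P₂.map τ = Q₂ at *
  generalize P₃.map τ = Q₃ at *
  generalize P₄.map τ = Q₄ at *
  -- The images of `P₁, P₂` are distinct fixed points with equal multipliers, and `{P₁, P₂}` is the
  -- only such pair.
  have c12 : Q₁ = P₁ ∧ Q₂ = P₂ ∨ Q₁ = P₂ ∧ Q₂ = P₁ := by
    clear m3 m4 n13 n14 n23 n24 n34
    grind
  grind

end P1Map.IsSwapConfiguration

namespace CubicPair

open Polynomial P1Map

variable {K F : Type*} [Field K] [Field F] [IsAlgClosed F] [Algebra K F] {M : CubicPair K}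

/-- The minimal polynomial divides `fixPoly`, which has coefficients in `K` and is separable. -/
lemma isSeparable_of_mem_fixedPoints (hM : (M.map (algebraMap K F)).Nondegenerate)
    (h4 : (fixedPoints (M.map (algebraMap K F)).toRatFunc).encard = 4) {x : F}
    (hx : (x : OnePoint F) ∈ fixedPoints (M.map (algebraMap K F)).toRatFunc) :
    IsSeparable K x := by
  have h1 := hM.separable_fixPoly h4
  have h2 := hM.mem_roots_fixPoly hx
  rw [mem_roots hM.fixPoly_ne_zero, IsRoot, fixPoly_map, eval_map_algebraMap] at h2
  rw [fixPoly_map, separable_map] at h1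
  exact h1.of_dvd (minpoly.dvd K x h2)

lemma exists_map_eq_of_mem_fixedPoints (hM : (M.map (algebraMap K F)).Nondegenerate)
    (h4 : (fixedPoints (M.map (algebraMap K F)).toRatFunc).encard = 4) {P : OnePoint F}
    (hP : P ∈ fixedPoints (M.map (algebraMap K F)).toRatFunc) :
    ∃ P' : OnePoint (separableClosure K F), P'.map (algebraMap (separableClosure K F) F) = P := by
  induction P using OnePoint.rec with
  | infty => exact ⟨OnePoint.infty, rfl⟩
  | coe x => exact ⟨((⟨x, isSeparable_of_mem_fixedPoints hM h4 hP⟩ : separableClosure K F) :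
      OnePoint (separableClosure K F)), rfl⟩

end CubicPair

/-! ### Descent of the conjugate to the base field -/

namespace P1Map.IsSwapConfiguration

open CubicPair

section

variable {F : Type*} [Field F] [IsAlgClosed F] [DecidableEq F] {M : CubicPair F}
  {S : GL (Fin 2) F} {P₁ P₂ P₃ P₄ : OnePoint F}

lemma conj_eq_conj (h : IsSwapConfiguration M.toRatFunc S P₁ P₂ P₃ P₄) (hM : M.Nondegenerate)
    {ρ ρ' : PGL(2, F)} (hρ : IsPartialFixedPointMultiplierForm (conj ρ M.toRatFunc))
    (hρ' : IsPartialFixedPointMultiplierForm (conj ρ' M.toRatFunc)) :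
    conj ρ M.toRatFunc = conj ρ' M.toRatFunc := by
  obtain ⟨A, -, -, hA⟩ := h.exists_setOf_eq_pair hM
  have key {ρ} (hρ : IsPartialFixedPointMultiplierForm (conj ρ M.toRatFunc)) :
      conj ρ M.toRatFunc = conj (Matrix.ProjGenLinGroup.mk A) M.toRatFunc := by
    have : ρ ∈ {ρ : PGL(2, F) | IsPartialFixedPointMultiplierForm (conj ρ M.toRatFunc)} := hρ
    rw [hA] at this
    obtain rfl | rfl := this
    · rfl
    · exact hM.conj_mul_eq h.conj_eq A
  rw [key hρ, key hρ']

end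

variable {K F : Type*} [Field K] [Field F] [IsAlgClosed F] [Algebra K F] [DecidableEq F]
  {M : CubicPair K} {S : GL (Fin 2) F} {P₁ P₂ P₃ P₄ : OnePoint F}

lemma isDefinedOver_conj_mk [Normal K F]
    (h : IsSwapConfiguration (M.map (algebraMap K F)).toRatFunc S P₁ P₂ P₃ P₄)
    (hM : (M.map (algebraMap K F)).Nondegenerate) {A : GL (Fin 2) F}
    (h₁ : A • ((multiplier (M.map (algebraMap K F)).toRatFunc P₁ : F) : OnePoint F) = P₁)
    (h₃ : A • ((multiplier (M.map (algebraMap K F)).toRatFunc P₃ : F) : OnePoint F) = P₃)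
    (h₄ : A • ((multiplier (M.map (algebraMap K F)).toRatFunc P₄ : F) : OnePoint F) = P₄) :
    IsDefinedOver K (conj (Matrix.ProjGenLinGroup.mk A) (M.map (algebraMap K F)).toRatFunc) := by
  classical
  set i : separableClosure K F →+* F := algebraMap (separableClosure K F) F
  have hMi : (M.map (algebraMap K (separableClosure K F))).map i = M.map (algebraMap K F) := rfl
  have hP {P} (hP : P = P₁ ∨ P = P₂ ∨ P = P₃ ∨ P = P₄) : ∃ (Q : OnePoint (separableClosure K F)) (l : separableClosure K F), Q.map i = P ∧
      i l = multiplier (M.map (algebraMap K F)).toRatFunc P := by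
    have hP' : P ∈ fixedPoints (M.map (algebraMap K F)).toRatFunc := by
      rw [h.fixedPoints_eq]
      exact hP
    obtain ⟨Q, rfl⟩ := exists_map_eq_of_mem_fixedPoints hM h.encard_fixedPoints hP'
    have hm := hM.hasMultiplier_iff.2 ⟨hP', rfl⟩
    rw [← hMi] at hm
    obtain ⟨l, hl⟩ := hm.of_map
    exact ⟨Q, l, rfl, hl⟩
  obtain ⟨Q₁, l₁, hQ₁, hl₁⟩ := hP (P := P₁) (by simp)
  obtain ⟨Q₃, l₃, hQ₃, hl₃⟩ := hP (P := P₃) (by simp)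
  obtain ⟨Q₄, l₄, hQ₄, hl₄⟩ := hP (P := P₄) (by simp)
  obtain ⟨h13, h14, -, -, h34⟩ := h.points_ne
  obtain ⟨g13, g14, g34⟩ := h.multipliers_ne
  -- Points and multipliers all live over the separable closure, so the interpolating matrix can be
  -- chosen there; it represents the same class as `A`.
  obtain ⟨T, hT₁, hT₃, hT₄⟩ := OnePoint.exists_GL_smul_eq_three
    (P := (l₁ : OnePoint (separableClosure K F))) (Q := l₃) (R := l₄) (P' := Q₁) (Q' := Q₃)
    (R' := Q₄)
    (by rintro e; rw [← hl₁, ← hl₃, OnePoint.coe_injective e] at g13; exact g13 rfl)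
    (by rintro e; rw [← hl₁, ← hl₄, OnePoint.coe_injective e] at g14; exact g14 rfl)
    (by rintro e; rw [← hl₃, ← hl₄, OnePoint.coe_injective e] at g34; exact g34 rfl)
    (by rintro rfl; exact h13 (hQ₁.symm.trans hQ₃))
    (by rintro rfl; exact h14 (hQ₁.symm.trans hQ₄))
    (by rintro rfl; exact h34 (hQ₃.symm.trans hQ₄))
  replace hT₁ := congrArg (OnePoint.map i) hT₁
  replace hT₃ := congrArg (OnePoint.map i) hT₃
  replace hT₄ := congrArg (OnePoint.map i) hT₄
  rw [OnePoint.map_smul, OnePoint.map_some] at hT₁ hT₃ hT₄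
  rw [hl₁, hQ₁] at hT₁
  rw [hl₃, hQ₃] at hT₃
  rw [hl₄, hQ₄] at hT₄
  have hform := (h.isPartialFixedPointMultiplierForm_conj_iff hM (T.map i)).2 ⟨.inl hT₁, hT₃, hT₄⟩
  rw [← OnePoint.mk_eq_mk_of_smul_eq g13 g14 g34 (hT₁.trans h₁.symm) (hT₃.trans h₃.symm)
    (hT₄.trans h₄.symm), hM.conj_toRatFunc]
  refine (hM.conj _).isDefinedOver
    (N := (M.map (algebraMap K (separableClosure K F))).conj T) (map_conj _ _ _) fun τ ↦ ?_
  rw [map_conj, map_algebraMap_map]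
  refine ⟨hM.conj _, ?_⟩
  rw [← hM.conj_toRatFunc, ← hM.conj_toRatFunc]
  refine h.conj_eq_conj hM ?_ hform
  rw [h.isPartialFixedPointMultiplierForm_conj_iff hM]
  -- Applying `τ` to the matching equations shows that the transformed matrix matches the permuted
  -- points, so it is again a solution and yields the same conjugate.
  have hτ {P : OnePoint F} (hP : P = P₁ ∨ P = P₂ ∨ P = P₃ ∨ P = P₄)
      (hT : T.map i • ((multiplier (M.map (algebraMap K F)).toRatFunc P : F) : OnePoint F) = P) :
      (T.map i).map (τ : F →+* F) •
        ((multiplier (M.map (algebraMap K F)).toRatFunc (P.map τ) : F) : OnePoint F) =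
          P.map τ := by
    rw [(map_mem_fixedPoints hM τ (by rw [h.fixedPoints_eq]; exact hP)).2]
    have := congrArg (OnePoint.map (τ : F →+* F)) hT
    rwa [OnePoint.map_smul] at this
  have t1 := hτ (by simp) hT₁
  have t3 := hτ (by simp) hT₃
  have t4 := hτ (by simp) hT₄
  obtain ⟨c12, c34⟩ := h.map_algEquiv hM τ
  constructor
  · rcases c12 with ⟨e1, -⟩ | ⟨e1, -⟩ <;> rw [e1] at t1
    · exact .inl t1
    · rw [h.multiplier_eq] at t1
      exact .inr t1
  · rcases c34 with ⟨e3, e4⟩ | ⟨e3, e4⟩ <;> rw [e3] at t3 <;> rw [e4] at t4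
    · exact ⟨t3, t4⟩
    · exact ⟨t4, t3⟩

lemma isDefinedOver_conj [Normal K F]
    (h : IsSwapConfiguration (M.map (algebraMap K F)).toRatFunc S P₁ P₂ P₃ P₄)
    (hM : (M.map (algebraMap K F)).Nondegenerate) {ρ : PGL(2, F)}
    (hρ : IsPartialFixedPointMultiplierForm (conj ρ (M.map (algebraMap K F)).toRatFunc)) :
    IsDefinedOver K (conj ρ (M.map (algebraMap K F)).toRatFunc) := by
  induction ρ using Matrix.ProjGenLinGroup.induction_on with | mk A => ?_
  obtain ⟨h1 | h1, h3, h4⟩ := (h.isPartialFixedPointMultiplierForm_conj_iff hM A).1 hρ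
  · exact h.isDefinedOver_conj_mk hM h1 h3 h4
  · exact h.symm.isDefinedOver_conj_mk hM (by rw [h.multiplier_eq, h1]) h3 h4

lemma map_map_eq_self (h : IsSwapConfiguration (M.map (algebraMap K F)).toRatFunc S P₁ P₂ P₃ P₄)
    (hM : (M.map (algebraMap K F)).Nondegenerate) (τ : F ≃ₐ[K] F) {P : OnePoint F}
    (hP : P ∈ fixedPoints (M.map (algebraMap K F)).toRatFunc) : (P.map τ).map τ = P := by
  rw [h.fixedPoints_eq] at hP
  obtain ⟨⟨e1, e2⟩ | ⟨e1, e2⟩, ⟨e3, e4⟩ | ⟨e3, e4⟩⟩ := h.map_algEquiv hM τ <;>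
    obtain rfl | rfl | rfl | rfl := hP <;> simp only [e1, e2, e3, e4]

/-- On each of the two preserved pairs the action is trivial or a swap, so one point of each pair
determines it. -/
lemma map_eq_map (h : IsSwapConfiguration (M.map (algebraMap K F)).toRatFunc S P₁ P₂ P₃ P₄)
    (hM : (M.map (algebraMap K F)).Nondegenerate) {τ τ' : F ≃ₐ[K] F}
    (h₁ : P₁.map τ = P₁ ↔ P₁.map τ' = P₁) (h₃ : P₃.map τ = P₃ ↔ P₃.map τ' = P₃) {P : OnePoint F}
    (hP : P ∈ fixedPoints (M.map (algebraMap K F)).toRatFunc) : P.map τ = P.map τ' := by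
  rw [h.fixedPoints_eq] at hP
  have n12 := h.ne₁₂
  obtain ⟨-, -, -, -, n34⟩ := h.points_ne
  have c := h.map_algEquiv hM τ
  have c' := h.map_algEquiv hM τ'
  obtain rfl | rfl | rfl | rfl := hP <;> grind

end P1Map.IsSwapConfiguration

/-! ### The first dynatomic Galois group -/

namespace P1Map

variable {K : Type*} [Field K]

lemma firstDynatomicGaloisGroup_ext {f : RatFunc K} {φ ψ : FirstDynatomicGaloisGroup f}
    (h : ∀ (x : firstDynatomicField f), ((x : AlgebraicClosure K) : OnePoint (AlgebraicClosure K)) ∈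
        fixedPoints (baseChange (AlgebraicClosure K) f) → φ x = ψ x) : φ = ψ := by
  have : (φ : firstDynatomicField f →ₐ[K] firstDynatomicField f) = ψ :=
    IntermediateField.algHom_ext_of_eq_adjoin K rfl fun x hx ↦ h _ hx
  exact AlgEquiv.coe_toAlgHom_injective this

lemma IsSwapConfiguration.firstDynatomicGaloisGroup [DecidableEq (AlgebraicClosure K)]
    {f : RatFunc K} {M : CubicPair K}
    (hf : baseChange (AlgebraicClosure K) f =
      (M.map (algebraMap K (AlgebraicClosure K))).toRatFunc)
    (hM : (M.map (algebraMap K (AlgebraicClosure K))).Nondegenerate)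
    {S : GL (Fin 2) (AlgebraicClosure K)} {P₁ P₂ P₃ P₄ : OnePoint (AlgebraicClosure K)}
    (h : IsSwapConfiguration (M.map (algebraMap K (AlgebraicClosure K))).toRatFunc S P₁ P₂ P₃ P₄) :
    Nonempty (FirstDynatomicGaloisGroup f ≃* Unit) ∨
      Nonempty (FirstDynatomicGaloisGroup f ≃* Multiplicative (ZMod 2)) ∨
      Nonempty (FirstDynatomicGaloisGroup f ≃*
        Multiplicative (ZMod 2) × Multiplicative (ZMod 2)) := by
  let lift (φ : FirstDynatomicGaloisGroup f) : AlgebraicClosure K ≃ₐ[K] AlgebraicClosure K :=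
    φ.liftNormal (AlgebraicClosure K)
  have hlift (φ : FirstDynatomicGaloisGroup f) (x : firstDynatomicField f) :
      lift φ x = φ x := φ.liftNormal_commutes (AlgebraicClosure K) x
  -- Two truth values, whether each pair is fixed pointwise, determine the action on the generators;
  -- this bounds the order by four.
  let r (φ : FirstDynatomicGaloisGroup f) : Prop × Prop :=
    (P₁.map (lift φ) = P₁, P₃.map (lift φ) = P₃)
  have hr : Function.Injective r := by
    intro φ ψ e
    rw [Prod.mk.injEq, eq_iff_iff, eq_iff_iff] at e
    refine firstDynatomicGaloisGroup_ext fun x hx ↦ ?_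
    rw [hf] at hx
    have := h.map_eq_map hM e.1 e.2 hx
    rw [OnePoint.map_some, OnePoint.map_some, OnePoint.coe_eq_coe, hlift, hlift] at this
    exact Subtype.ext this
  have : Finite (FirstDynatomicGaloisGroup f) := Finite.of_injective r hr
  apply nonempty_mulEquiv_of_mul_self_eq_one
  · intro φ
    refine firstDynatomicGaloisGroup_ext fun x hx ↦ ?_
    rw [hf] at hx
    have := h.map_map_eq_self hM (lift φ) hx
    rw [OnePoint.map_some, OnePoint.map_some, OnePoint.coe_eq_coe, hlift, hlift] at this
    exact Subtype.ext this
  · refine (Nat.card_le_card_of_injective r hr).trans ?_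
    simp

end P1Map

/-! ### The main theorem -/

theorem mainTheorem8 (K : Type*) [Field K] (f : RatFunc K) (hdeg : P1Map.degree f = 3)
    (hAut : (P1Map.automorphisms (P1Map.baseChange (AlgebraicClosure K) f)).encard = 2)
    (hFix : 3 ≤ (P1Map.fixedPoints (P1Map.baseChange (AlgebraicClosure K) f)).encard) :
    ((∃ ρ : PGL(2, AlgebraicClosure K), P1Map.IsPartialFixedPointMultiplierForm
          (P1Map.conj ρ (P1Map.baseChange (AlgebraicClosure K) f))) ↔
        ((P1Map.fixedPoints (P1Map.baseChange (AlgebraicClosure K) f)).encard = 4 ∧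
          (Nonempty (P1Map.FirstDynatomicGaloisGroup f ≃* Unit) ∨
            Nonempty (P1Map.FirstDynatomicGaloisGroup f ≃* Multiplicative (ZMod 2)) ∨
            Nonempty (P1Map.FirstDynatomicGaloisGroup f ≃*
              Multiplicative (ZMod 2) × Multiplicative (ZMod 2))) ∧
          3 ≤ (P1Map.multipliers (P1Map.baseChange (AlgebraicClosure K) f)).encard)) ∧
      (3 ≤ (P1Map.multipliers (P1Map.baseChange (AlgebraicClosure K) f)).encard →
        {ρ : PGL(2, AlgebraicClosure K) | P1Map.IsPartialFixedPointMultiplierForm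
          (P1Map.conj ρ (P1Map.baseChange (AlgebraicClosure K) f))}.encard = 2) ∧
      (∀ ρ : PGL(2, AlgebraicClosure K), P1Map.IsPartialFixedPointMultiplierForm
          (P1Map.conj ρ (P1Map.baseChange (AlgebraicClosure K) f)) →
        P1Map.IsDefinedOver K (P1Map.conj ρ (P1Map.baseChange (AlgebraicClosure K) f))) := by
  classical
  obtain ⟨M, hM, hf⟩ := P1Map.exists_cubicPair (F := AlgebraicClosure K) hdeg
  obtain ⟨σ, hσ, hσ1⟩ := (Set.one_lt_encard_iff_nontrivial.1
    (hAut ▸ (by norm_num : (1 : ℕ∞) < 2))).exists_ne 1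
  obtain ⟨S, rfl⟩ := Matrix.ProjGenLinGroup.mk_surjective σ
  rw [hf] at hFix ⊢
  replace hσ : P1Map.conj (Matrix.ProjGenLinGroup.mk S)
    (M.map (algebraMap K (AlgebraicClosure K))).toRatFunc = _ := hf ▸ hσ
  have config := hM.exists_isSwapConfiguration hσ hσ1
  -- A matching point is recovered from its multiplier by `P = A • λ(P)`, so the multiplier is
  -- injective on the matching points.
  have hmult (ρ : PGL(2, AlgebraicClosure K)) (hρ : P1Map.IsPartialFixedPointMultiplierForm
      (P1Map.conj ρ (M.map (algebraMap K (AlgebraicClosure K))).toRatFunc)) : 3 ≤ (P1Map.multipliers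
        (M.map (algebraMap K (AlgebraicClosure K))).toRatFunc).encard := by
    induction ρ using Matrix.ProjGenLinGroup.induction_on with | mk A => ?_
    refine ((hM.isPartialFixedPointMultiplierForm_conj_iff hFix A).1 hρ).2.trans ?_
    rw [← Set.InjOn.encard_image (f := P1Map.multiplier
      (M.map (algebraMap K (AlgebraicClosure K))).toRatFunc)]
    · exact Set.encard_le_encard (Set.image_mono fun P hP ↦ hP.1)
    · rintro P ⟨-, hP⟩ Q ⟨-, hQ⟩ e
      rw [hP, hQ, e]
  refine ⟨⟨?_, ?_⟩, ?_, ?_⟩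
  · rintro ⟨ρ, hρ⟩
    obtain ⟨P₁, P₂, P₃, P₄, h⟩ := config (hmult ρ hρ)
    exact ⟨h.encard_fixedPoints, h.firstDynatomicGaloisGroup hf hM, hmult ρ hρ⟩
  -- Three distinct multipliers already produce the swap configuration and hence a solution.
  · rintro ⟨-, -, h3⟩
    obtain ⟨P₁, P₂, P₃, P₄, h⟩ := config h3
    obtain ⟨A, -, -, hA⟩ := h.exists_setOf_eq_pair hM
    exact ⟨_, hA.ge (Set.mem_insert _ _)⟩
  · intro h3
    obtain ⟨P₁, P₂, P₃, P₄, h⟩ := config h3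
    obtain ⟨A, -, hne, hA⟩ := h.exists_setOf_eq_pair hM
    rw [hA, Set.encard_pair hne]
  · intro ρ hρ
    obtain ⟨P₁, P₂, P₃, P₄, h⟩ := config (hmult ρ hρ)
    exact h.isDefinedOver_conj hM hρ
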